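/- For a length vector $\lambda=(\lambda_A,\lambda_B,\lambda_C)$ in the simplex $\Delta=\{\lambda\in\mathbb{R}^3:\lambda_A,\lambda_B,\lambda_C>0,\ \lambda_A+\lambda_B+\lambda_C=1\}$, let $T=T_\lambda:[0,1)\to[0,1)$ be the symmetric 3-interval exchange transformation (3-IET) with permutation $\begin{pmatrix}A&B&C\\C&B&A\end{pmatrix}$, that is, $$T(x)=\begin{cases}x+\lambda_B+\lambda_C,&0\le x<\lambda_A,\\ x+\lambda_C-\lambda_A,&\lambda_A\le x<\lambda_A+\lambda_B,\\ x-\lambda_A-\lambda_B,&\lambda_A+\lambda_B\le x<1.\end{cases}$$ Let $f(x)=\sin(2\pi x)$ and let $T_f:[0,1)\times\mathbb{R}\to[0,1)\times\mathbb{R}$, $T_f(x,t)=(Tx,\,t+f(x))$, be the associated skew product. Then: 1. For almost every $\lambda\in\Delta$ (with respect to two-dimensional Lebesgue measure on $\Delta$), $T_f$, which preserves the product measure $\mathrm{Leb}_{[0,1)}\otimes\mathrm{Leb}_{\mathbb{R}}$, is not ergodic with respect to this measure. 2. The set of $\lambda\in\Delta$ for which $T_f$ is ergodic with respect to $\mathrm{Leb}_{[0,1)}\otimes\mathrm{Leb}_{\mathbb{R}}$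 is dense in $\Delta$. -/

import Mathlib

open MeasureTheory

noncomputable section

namespace IntervalExchange

/-- The total length of the intervals that come strictly before `I_a` when the intervals are
lined up in the order prescribed by `π`; that is, the left endpoint of the interval with label `a`
in this arrangement. -/
def leftEnd {A : Type*} [Fintype A] {d : ℕ} (π : A ≃ Fin d) (len : A → ℝ) (a : A) : ℝ :=
  ∑ b with π b < π a, len b

/-- The interval `I_a`, for the top order `πt`. -/
def piece {A : Type*} [Fintype A] {d : ℕ} (πt : A ≃ Fin d) (len : A → ℝ) (a : A) : Set ℝ :=
  Set.Ico (leftEnd πt len a) (leftEnd πt len a + len a)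

/-- The interval exchange transformation with lengths `len`, whose intervals are ordered by `πt`
before the exchange and by `πb` after it: on `I_a` it is the translation that takes the left
endpoint of `I_a` to its new position. It is an exchange of the pieces of `[0, ∑ a, len a)`;
outside of this interval the total function on `ℝ` is the identity. -/
def iet {A : Type*} [Fintype A] {d : ℕ} (πt πb : A ≃ Fin d) (len : A → ℝ) (x : ℝ) : ℝ :=
  x + ∑ a, (piece πt len a).indicator (fun _ => leftEnd πb len a - leftEnd πt len a) x

/-- The symmetric 3-IET: the intervals `A B C` (labels `0 1 2`) are rearranged as `C B A`. -/
def symIet (len : Fin 3 → ℝ) : ℝ → ℝ :=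
  iet (Equiv.refl (Fin 3)) Fin.revPerm len

/-- The skew product `T_f (x, t) = (T x, t + f x)`. -/
def skewProduct {X : Type*} (T : X → X) (f : X → ℝ) (p : X × ℝ) : X × ℝ :=
  (T p.1, p.2 + f p.1)

/-- The measure `Leb_{[0,1)} ⊗ Leb_ℝ` on `[0,1) × ℝ`. -/
def cylinderMeasure : Measure (ℝ × ℝ) :=
  ((volume : Measure ℝ).restrict (Set.Ico 0 1)).prod (volume : Measure ℝ)

/-- The parameter space of symmetric 3-IETs on `[0,1)`: positive length vectors of total
length one. -/
def lengthSimplex : Set (Fin 3 → ℝ) :=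
  {len | (∀ a, 0 < len a) ∧ ∑ a, len a = 1}

/-- The affine parametrization of the plane `∑ a, len a = 1` by its first two coordinates. -/
def simplexParam (p : ℝ × ℝ) : Fin 3 → ℝ :=
  ![p.1, p.2, 1 - p.1 - p.2]

/-- (Two-dimensional) Lebesgue measure on the simplex of length vectors. -/
def simplexMeasure : Measure (Fin 3 → ℝ) :=
  ((volume : Measure (ℝ × ℝ)).restrict (simplexParam ⁻¹' lengthSimplex)).map simplexParam

theorem measurable_simplexParam : Measurable simplexParam := by
  refine measurable_pi_lambda _ fun i => ?_
  fin_cases i <;> simp [simplexParam] <;> fun_prop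

end IntervalExchange

end

open MeasureTheory Filter Topology
open scoped ENNReal

namespace IntervalExchange

/-! Put L = 1 + λ_B and α = λ_B + λ_C. The exchange is the map induced on `[0, 1)` by the rotation
by α of a circle of length L: points of the middle interval make one extra stop in `[1, L)`. As
sin(2πx) vanishes at both ends of `[0, 1)`, its extension by zero is continuous on the circle, and
both claims become questions about a skew product over a rotation.

Almost every λ: the extension has mean zero and, having only corners, Fourier coefficients O(n⁻²).
For almost every angle α/L the small divisors are summable against n⁻²
(`ae_summable_small_divisors`), so the extension is a coboundary g(y + α) - g(y) with g continuous,
and t - g(x) is an invariant function that is not constant.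

Density: let q/L be a half-integer. For the angle p/q, the Birkhoff sum over q² steps is q times a
sum over q equally spaced points. The corners at 0 and 1 are then half a grid step out of phase, so
their contributions do not cancel and leave a tent function of qy (`circleSin_sum_sub_tent_le`). By
Baire category the generic angle inherits this along some q = 3^m → ∞, with q²α → 0. The phase qy
becomes independent of y, so an invariant set is invariant under vertical translation by almost
every value of the tent. These values include arbitrarily small nonzero ones, hence every fibre is
null or conull, and ergodicity of the rotation concludes (`preErgodic_skewProduct_rotation`). -/

/-! ### The exchange as a piecewise translation, and invariance of the measures. -/

theorem symIet_apply (len : Fin 3 → ℝ) (x : ℝ) :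
    symIet len x = x + ((Set.Ico 0 (len 0)).indicator (fun _ => len 1 + len 2) x
      + (Set.Ico (len 0) (len 0 + len 1)).indicator (fun _ => len 2 - len 0) x
      + (Set.Ico (len 0 + len 1) (len 0 + len 1 + len 2)).indicator
          (fun _ => -(len 0 + len 1)) x) := by
  have h (π : Fin 3 ≃ Fin 3) (a : Fin 3) : leftEnd π len a
      = (if π 0 < π a then len 0 else 0) + (if π 1 < π a then len 1 else 0)
        + (if π 2 < π a then len 2 else 0) := by
    rw [leftEnd, Finset.sum_filter, Fin.sum_univ_three]
  have h1 : leftEnd (Equiv.refl (Fin 3)) len 0 = 0 := by rw [h]; simp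
  have h2 : leftEnd (Equiv.refl (Fin 3)) len 1 = len 0 := by rw [h]; simp
  have h3 : leftEnd (Equiv.refl (Fin 3)) len 2 = len 0 + len 1 := by rw [h]; simp
  have h4 : leftEnd Fin.revPerm len 0 = len 1 + len 2 := by rw [h]; simp
  have h5 : leftEnd Fin.revPerm len 1 = len 2 := by rw [h]; simp
  have h6 : leftEnd Fin.revPerm len 2 = 0 := by rw [h]; simp
  rw [symIet, iet, Fin.sum_univ_three]
  simp only [piece, h1, h2, h3, h4, h5, h6, zero_add, zero_sub, sub_zero]

theorem measurable_symIet (len : Fin 3 → ℝ) : Measurable (symIet len) := by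
  have : symIet len = fun x => _ := funext (symIet_apply len)
  rw [this]
  refine measurable_id.add (((measurable_const.indicator measurableSet_Ico).add
    (measurable_const.indicator measurableSet_Ico)).add
    (measurable_const.indicator measurableSet_Ico))

section Pieces

variable {len : Fin 3 → ℝ} (hl : len ∈ lengthSimplex)
include hl

theorem symIet_of_lt {x : ℝ} (h0 : 0 ≤ x) (h : x < len 0) :
    symIet len x = x + (len 1 + len 2) := by
  obtain ⟨hp, hs⟩ := hl
  rw [Fin.sum_univ_three] at hs
  have := hp 0; have := hp 1; have := hp 2
  rw [symIet_apply, Set.indicator_of_mem (by constructor <;> linarith),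
    Set.indicator_of_notMem (by rintro ⟨h1, h2⟩; linarith),
    Set.indicator_of_notMem (by rintro ⟨h1, h2⟩; linarith)]
  ring

theorem symIet_of_mid {x : ℝ} (h0 : len 0 ≤ x) (h : x < len 0 + len 1) :
    symIet len x = x + (len 2 - len 0) := by
  obtain ⟨hp, hs⟩ := hl
  rw [Fin.sum_univ_three] at hs
  have := hp 0; have := hp 1; have := hp 2
  rw [symIet_apply, Set.indicator_of_notMem (by rintro ⟨h1, h2⟩; linarith),
    Set.indicator_of_mem (by constructor <;> linarith),
    Set.indicator_of_notMem (by rintro ⟨h1, h2⟩; linarith)]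
  ring

theorem symIet_of_ge {x : ℝ} (h0 : len 0 + len 1 ≤ x) (h : x < 1) :
    symIet len x = x + -(len 0 + len 1) := by
  obtain ⟨hp, hs⟩ := hl
  rw [Fin.sum_univ_three] at hs
  have := hp 0; have := hp 1; have := hp 2
  rw [symIet_apply, Set.indicator_of_notMem (by rintro ⟨h1, h2⟩; linarith),
    Set.indicator_of_notMem (by rintro ⟨h1, h2⟩; linarith),
    Set.indicator_of_mem (by constructor <;> linarith)]
  ring

end Pieces

theorem map_add_const_restrict_Ico (a b s : ℝ) :
    ((volume : Measure ℝ).restrict (Set.Ico a b)).map (· + s)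
      = volume.restrict (Set.Ico (a + s) (b + s)) := by
  have := (measurePreserving_add_right (volume : Measure ℝ) s).restrict_preimage
    (s := Set.Ico (a + s) (b + s)) measurableSet_Ico
  rw [← this.map_eq]
  congr 2
  ext x; simp

theorem restrict_Ico_add {a b c : ℝ} (hab : a ≤ b) (hbc : b ≤ c) :
    (volume : Measure ℝ).restrict (Set.Ico a c)
      = volume.restrict (Set.Ico a b) + volume.restrict (Set.Ico b c) := by
  rw [← Measure.restrict_union (Set.Ico_disjoint_Ico_same) measurableSet_Ico,
    Set.Ico_union_Ico_eq_Ico hab hbc]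

theorem map_symIet_restrict {len : Fin 3 → ℝ} {a b s : ℝ}
    (h : ∀ x ∈ Set.Ico a b, symIet len x = x + s) :
    (volume.restrict (Set.Ico a b)).map (symIet len)
      = volume.restrict (Set.Ico (a + s) (b + s)) := by
  rw [← map_add_const_restrict_Ico]
  refine Measure.map_congr ?_
  filter_upwards [ae_restrict_mem measurableSet_Ico] with x hx using h x hx

theorem measurePreserving_symIet {len : Fin 3 → ℝ} (hl : len ∈ lengthSimplex) :
    MeasurePreserving (symIet len) (volume.restrict (Set.Ico 0 1))
      (volume.restrict (Set.Ico 0 1)) := by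
  have hl' := hl
  obtain ⟨hp, hs⟩ := hl'
  rw [Fin.sum_univ_three] at hs
  have ha := hp 0; have hb := hp 1; have hc := hp 2
  refine ⟨measurable_symIet len, ?_⟩
  conv_lhs => rw [restrict_Ico_add (b := len 0) (by linarith) (by linarith),
    restrict_Ico_add (a := len 0) (b := len 0 + len 1) (by linarith) (by linarith)]
  rw [Measure.map_add _ _ (measurable_symIet len), Measure.map_add _ _ (measurable_symIet len),
    map_symIet_restrict fun x hx => symIet_of_lt hl hx.1 hx.2,
    map_symIet_restrict fun x hx => symIet_of_mid hl hx.1 hx.2,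
    map_symIet_restrict fun x hx => symIet_of_ge hl hx.1 hx.2,
    -- The target is cut in the order C, B, A, in which the images of the pieces tile it.
    restrict_Ico_add (a := 0) (b := len 2) (c := 1) (by linarith) (by linarith),
    restrict_Ico_add (a := len 2) (b := len 1 + len 2) (c := 1) (by linarith) (by linarith)]
  have e1 : len 0 + (len 1 + len 2) = 1 := by linarith
  have e2 : len 0 + (len 2 - len 0) = len 2 := by ring
  have e3 : len 0 + len 1 + (len 2 - len 0) = len 1 + len 2 := by ring
  have e4 : len 0 + len 1 + -(len 0 + len 1) = 0 := by ring
  have e5 : 1 + -(len 0 + len 1) = len 2 := by linarith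
  rw [e1, e2, e3, e4, e5, zero_add]
  abel

theorem measurePreserving_skewProduct {X : Type*} [MeasurableSpace X] {μ : Measure X} [SFinite μ]
    {T : X → X} (hT : MeasurePreserving T μ μ) {f : X → ℝ} (hf : Measurable f) :
    MeasurePreserving (skewProduct T f) (μ.prod (volume : Measure ℝ)) (μ.prod volume) := by
  refine hT.skew_product (g := fun x t => t + f x) ?_ (Filter.Eventually.of_forall fun x => ?_)
  · exact measurable_snd.add (hf.comp measurable_fst)
  · exact (measurePreserving_add_right volume (f x)).map_eq

theorem measurePreserving_skewProduct_symIet {len : Fin 3 → ℝ} (hl : len ∈ lengthSimplex) :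
    MeasurePreserving (skewProduct (symIet len) (fun x : ℝ => Real.sin (2 * Real.pi * x)))
      cylinderMeasure cylinderMeasure :=
  measurePreserving_skewProduct (measurePreserving_symIet hl) (by fun_prop)

/-! ### The exchange as an induced map of a rotation. -/

/-- The function on the circle of length `L ≥ 1` that is `sin (2 π x)` on `[0, 1)` and vanishes
elsewhere. -/
noncomputable def circleSin (L : ℝ) [Fact (0 < L)] : AddCircle L → ℝ :=
  AddCircle.liftIco L 0 fun x => Real.sin (2 * Real.pi * min x 1)

section CircleSin

variable {L : ℝ} [hL : Fact (0 < L)]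

/-- The sine vanishes at 0 and at 1, so freezing it at its value at 1 glues continuously. Both
halves of the theorem rest on this. -/
theorem continuous_circleSin (h1 : 1 ≤ L) : Continuous (circleSin L) := by
  refine AddCircle.liftIco_zero_continuous ?_ (by fun_prop)
  simp [h1]

theorem circleSin_of_lt_one (h1 : 1 ≤ L) {x : ℝ} (h0 : 0 ≤ x) (hx : x < 1) :
    circleSin L x = Real.sin (2 * Real.pi * x) := by
  rw [circleSin, AddCircle.liftIco_zero_coe_apply ⟨h0, by linarith⟩, min_eq_left hx.le]

theorem circleSin_of_one_le {x : ℝ} (h0 : 1 ≤ x) (hx : x < L) :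
    circleSin L x = 0 := by
  rw [circleSin, AddCircle.liftIco_zero_coe_apply ⟨by linarith, hx⟩, min_eq_right h0]
  simp

theorem exists_coe_eq_mem_Ico (y : AddCircle L) :
    ∃ x : ℝ, (x : AddCircle L) = y ∧ 0 ≤ x ∧ x < L := by
  refine ⟨AddCircle.equivIco L 0 y, AddCircle.coe_equivIco, ?_, ?_⟩
  · exact (AddCircle.equivIco L 0 y).2.1
  · simpa using (AddCircle.equivIco L 0 y).2.2

/-- The first entrance to `[0, 1)` of the rotation by `α` of the circle of length `L`, in the
coordinate of `[0, L)`. -/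
noncomputable def entrance (L α x : ℝ) : ℝ := if x < 1 then x else x + α - L

/-- The coordinate in `[0, 1)` of the first entrance of a point of the circle to `[0, 1)` under
the rotation by `α`. -/
noncomputable def circleEntrance (L α : ℝ) [Fact (0 < L)] : AddCircle L → ℝ :=
  AddCircle.liftIco L 0 (entrance L α)

theorem measurable_circleEntrance (α : ℝ) : Measurable (circleEntrance L α) := by
  have h : Measurable (entrance L α) :=
    Measurable.ite (measurableSet_Iio) measurable_id (by fun_prop)
  have : circleEntrance L α
      = fun y => entrance L α (AddCircle.measurableEquivIco L 0 y) := rfl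
  rw [this]
  exact h.comp (measurable_subtype_coe.comp (AddCircle.measurableEquivIco L 0).measurable)

theorem circleEntrance_of_lt_one (h1 : 1 ≤ L) (α : ℝ) {x : ℝ} (h0 : 0 ≤ x) (hx : x < 1) :
    circleEntrance L α x = x := by
  rw [circleEntrance, AddCircle.liftIco_zero_coe_apply ⟨h0, by linarith⟩, entrance, if_pos hx]

theorem circleEntrance_of_one_le (α : ℝ) {x : ℝ} (h0 : 1 ≤ x) (hx : x < L) :
    circleEntrance L α x = x + α - L := by
  rw [circleEntrance, AddCircle.liftIco_zero_coe_apply ⟨by linarith, hx⟩, entrance,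
    if_neg (not_lt.2 h0)]

end CircleSin

section Conjugacy

variable {len : Fin 3 → ℝ} (hl : len ∈ lengthSimplex) {L : ℝ} [hL : Fact (0 < L)]
  (hLlen : L = 1 + len 1)
include hl hLlen

/-- The rotation of the circle of length `1 + len 1` by `len 1 + len 2` and the interval
exchange are related by the entrance map: inside `[0, 1)` the entrance point moves by the
exchange, outside it stays. -/
theorem skewProduct_entrance (E : Set (ℝ × ℝ))
    (hE : skewProduct (symIet len) (fun x : ℝ => Real.sin (2 * Real.pi * x)) ⁻¹' E = E)
    (y : AddCircle L) (t : ℝ) :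
    (circleEntrance L (len 1 + len 2) (y + ((len 1 + len 2 : ℝ) : AddCircle L)),
      t + circleSin L y) ∈ E ↔ (circleEntrance L (len 1 + len 2) y, t) ∈ E := by
  have hl' := hl
  obtain ⟨hp, hs⟩ := hl'
  rw [Fin.sum_univ_three] at hs
  have ha := hp 0; have hb := hp 1; have hc := hp 2
  have h1L : 1 ≤ L := by linarith
  set α := len 1 + len 2 with hα
  have key : ∀ x s : ℝ, (symIet len x, s + Real.sin (2 * Real.pi * x)) ∈ E ↔ (x, s) ∈ E := by
    intro x s
    conv_rhs => rw [← hE]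
    rfl
  have hper : ∀ x : ℝ, ((x - L : ℝ) : AddCircle L) = x := by
    intro x; simp
  obtain ⟨x, rfl, h0, hx⟩ := exists_coe_eq_mem_Ico y
  rw [← AddCircle.coe_add]
  rcases lt_or_ge x 1 with h1 | h1
  · rw [circleEntrance_of_lt_one h1L α h0 h1, circleSin_of_lt_one h1L h0 h1, ← key x t]
    rcases lt_or_ge x (len 0) with h2 | h2
    · rw [circleEntrance_of_lt_one h1L α (by linarith) (by linarith), symIet_of_lt hl h0 h2]
    · rcases lt_or_ge x (len 0 + len 1) with h3 | h3
      -- On the middle piece one rotation step lands in `[1, L)`, whose entrance point is already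
      -- the image under the exchange.
      · rw [circleEntrance_of_one_le α (by linarith) (by linarith), symIet_of_mid hl h2 h3]
        have : x + α + α - L = x + (len 2 - len 0) := by linarith
        rw [this]
      · rw [← hper, circleEntrance_of_lt_one h1L α (by linarith) (by linarith),
          symIet_of_ge hl h3 h1]
        have : x + α - L = x + -(len 0 + len 1) := by linarith
        rw [this]
  · rw [circleEntrance_of_one_le α h1 hx, circleSin_of_one_le h1 hx, add_zero, ← hper,
      circleEntrance_of_lt_one h1L α (by linarith) (by linarith)]

omit hl hLlen in
theorem quasiMeasurePreserving_coe_cylinder (h1 : 1 ≤ L) :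
    Measure.QuasiMeasurePreserving (fun p : ℝ × ℝ => ((p.1 : AddCircle L), p.2))
      cylinderMeasure ((volume : Measure (AddCircle L)).prod volume) := by
  have h := (AddCircle.measurePreserving_mk L 0).prod (MeasurePreserving.id (volume : Measure ℝ))
  refine h.quasiMeasurePreserving.mono_left ?_
  refine Measure.AbsolutelyContinuous.prod ?_ Measure.AbsolutelyContinuous.rfl
  rw [restrict_Ico_eq_restrict_Ioc]
  exact (Measure.restrict_mono (Set.Ioc_subset_Ioc_right (by linarith)) le_rfl).absolutelyContinuous

/-- The preimage of an invariant set under the entrance map is invariant for the skew product on the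
circle, hence trivial. The entrance map is the identity on `[0, 1)`, so triviality restricts to the
original set. -/
theorem ergodic_skewProduct_symIet
    (h : PreErgodic (skewProduct (fun y : AddCircle L => y + ((len 1 + len 2 : ℝ) : AddCircle L))
      (circleSin L)) ((volume : Measure (AddCircle L)).prod volume)) :
    Ergodic (skewProduct (symIet len) (fun x : ℝ => Real.sin (2 * Real.pi * x)))
      cylinderMeasure := by
  have h1L : 1 ≤ L := by linarith [hl.1 1]
  refine ⟨measurePreserving_skewProduct_symIet hl, ⟨fun E hE hinv => ?_⟩⟩
  set α := len 1 + len 2 with hα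
  have hψ : Measurable fun p : AddCircle L × ℝ => (circleEntrance L α p.1, p.2) :=
    ((measurable_circleEntrance α).comp measurable_fst).prodMk measurable_snd
  have hc := h.aeconst_set (hψ hE) (by
    ext ⟨y, t⟩
    exact skewProduct_entrance hl hLlen E hinv y t)
  have hq := quasiMeasurePreserving_coe_cylinder (L := L) h1L
  have h2 := hc.comp_tendsto hq.tendsto_ae
  refine h2.congr ?_
  have hmem : ∀ᵐ p ∂cylinderMeasure, p.1 ∈ Set.Ico (0 : ℝ) 1 := by
    exact Measure.quasiMeasurePreserving_fst.ae (ae_restrict_mem measurableSet_Ico)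
  filter_upwards [hmem] with p hp
  have : circleEntrance L α (p.1 : AddCircle L) = p.1 := circleEntrance_of_lt_one h1L α hp.1 hp.2
  change ((circleEntrance L α (p.1 : AddCircle L), p.2) ∈ E) = (p ∈ E)
  rw [this]

end Conjugacy

/-! ### An ergodicity criterion by small vertical translations. -/

/-- A set of reals that is almost invariant under arbitrarily small translations is null or
conull. -/
theorem eventuallyConst_of_small_ae_periods {s : Set ℝ} (hs : MeasurableSet s)
    (h : ∀ ε > 0, ∃ c : ℝ, 0 < |c| ∧ |c| < ε ∧ ∀ᵐ t, (t + c ∈ s ↔ t ∈ s)) :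
    EventuallyConst s (ae (volume : Measure ℝ)) := by
  classical
  set χ : ℝ → ℝ := s.indicator 1 with hχ
  have hχi : LocallyIntegrable χ volume :=
    (locallyIntegrable_const (1 : ℝ)).indicator hs
  have hint : ∀ a b, IntervalIntegrable χ volume a b := fun a b =>
    intervalIntegrable_iff.mpr <|
      (hχi.integrableOn_isCompact isCompact_uIcc).mono_set Set.uIoc_subset_uIcc
  set f : ℝ → ℝ := fun x => ∫ t in (0 : ℝ)..x, χ t with hf
  have hfc : Continuous f := intervalIntegral.continuous_primitive hint 0
  -- With f the primitive of the indicator, these c form a group containing every almost period.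
  -- Small periods make it dense, so by continuity f is additive, hence linear, and its almost
  -- everywhere derivative, the indicator, is constant.
  let S : AddSubgroup ℝ :=
    { carrier := {c | ∀ x, f (x + c) = f x + f c}
      add_mem' := by
        intro a b ha hb x
        have h1 := hb (x + a)
        have h2 := ha x
        have h3 := hb a
        rw [← add_assoc, h1, h2, h3, add_assoc]
      zero_mem' := by intro x; simp [hf]
      neg_mem' := by
        intro a ha x
        have h1 := ha (x + -a)
        have h2 := ha (-a)
        have h3 : f 0 = 0 := by simp [hf]
        simp only [neg_add_cancel, neg_add_cancel_right, h3] at h1 h2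
        linarith }
  have hmem : ∀ c : ℝ, (∀ᵐ t, (t + c ∈ s ↔ t ∈ s)) → c ∈ S := by
    intro c hc x
    have h1 : ∫ t in (0 : ℝ)..x, χ (t + c) = f x := by
      refine intervalIntegral.integral_congr_ae ?_
      filter_upwards [hc] with t ht _
      simp only [hχ, Set.indicator_apply, ht, Pi.one_apply]
    rw [intervalIntegral.integral_comp_add_right, zero_add] at h1
    have h2 := intervalIntegral.integral_add_adjacent_intervals (hint 0 c) (hint c (x + c))
    change f (x + c) = f x + f c
    rw [← h1, add_comm (∫ _ in _.._, _)]
    exact h2.symm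
  have hdense : Dense (S : Set ℝ) := by
    refine AddSubgroup.dense_of_not_isolated_zero S fun ε hε => ?_
    obtain ⟨c, h0, hlt, hc⟩ := h ε hε
    have hcS := hmem c hc
    rcases abs_choice c with h' | h'
    · exact ⟨|c|, h'.symm ▸ hcS, h0, hlt⟩
    · exact ⟨|c|, h'.symm ▸ S.neg_mem hcS, h0, hlt⟩
  have hadd : ∀ x c, f (x + c) = f x + f c := by
    intro x c
    have hcl : IsClosed {c | f (x + c) = f x + f c} :=
      isClosed_eq (by fun_prop) (by fun_prop)
    have : closure (S : Set ℝ) ⊆ {c | f (x + c) = f x + f c} :=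
      closure_minimal (fun c hc => hc x) hcl
    exact this (hdense c)
  let fa : ℝ →+ ℝ := AddMonoidHom.mk' f hadd
  have hlin : ∀ x, f x = x * f 1 := by
    intro x
    have := map_real_smul fa hfc x 1
    simpa [fa] using this
  have hderiv : ∀ x, HasDerivAt f (f 1) x := by
    intro x
    have h1 : HasDerivAt (fun x : ℝ => x * f 1) (1 * f 1) x := (hasDerivAt_id x).mul_const _
    rw [one_mul] at h1
    exact h1.congr_of_eventuallyEq (Eventually.of_forall hlin)
  have hae : ∀ᵐ x, χ x = f 1 := by
    filter_upwards [LocallyIntegrable.ae_hasDerivAt_integral hχi] with x hx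
    exact (hx 0).unique (hderiv x)
  rw [eventuallyConst_set]
  by_cases h1 : f 1 = 1
  · left
    filter_upwards [hae] with x hx
    by_contra hxs
    simp [hχ, hxs, h1] at hx
  · right
    filter_upwards [hae] with x hx hxs
    simp [hχ, hxs] at hx
    exact h1 hx.symm

theorem skewProduct_iterate {X : Type*} (T : X → X) (f : X → ℝ) (n : ℕ) (p : X × ℝ) :
    (skewProduct T f)^[n] p = (T^[n] p.1, p.2 + birkhoffSum T f n p.1) := by
  induction n with
  | zero => simp
  | succ n ih =>
    rw [Function.iterate_succ_apply', ih, birkhoffSum_succ, Function.iterate_succ_apply']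
    simp [skewProduct, add_assoc]

section Cylinder

variable {L : ℝ} [hL : Fact (0 < L)]

theorem measurePreserving_shear {β : AddCircle L} {g : AddCircle L → ℝ} (hg : Continuous g) :
    MeasurePreserving (fun p : AddCircle L × ℝ => (p.1 + β, p.2 + g p.1))
      ((volume : Measure (AddCircle L)).prod volume) (volume.prod volume) :=
  measurePreserving_skewProduct (measurePreserving_add_right volume β) hg.measurable

/-- The shear `(y, t) ↦ (y + β, t + g y)` of the cylinder as a continuous map. -/
noncomputable def shear (β : AddCircle L) (g : AddCircle L → ℝ) (hg : Continuous g) :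
    C(AddCircle L × ℝ, AddCircle L × ℝ) :=
  ⟨fun p => (p.1 + β, p.2 + g p.1), (continuous_fst.add continuous_const).prodMk
    (continuous_snd.add (hg.comp continuous_fst))⟩

/-- If shears converge uniformly to the identity, they move a set of finite measure by little. -/
theorem tendsto_measure_symmDiff_shear {β : ℕ → AddCircle L} {g : ℕ → AddCircle L → ℝ}
    (hg : ∀ k, Continuous (g k)) (hβ : Tendsto β atTop (𝓝 0))
    (hg0 : ∀ ε > 0, ∀ᶠ k in atTop, ∀ y, |g k y| < ε) {s : Set (AddCircle L × ℝ)}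
    (hs : MeasurableSet s) (hs' : ((volume : Measure (AddCircle L)).prod volume) s ≠ ⊤) :
    Tendsto (fun k => ((volume : Measure (AddCircle L)).prod (volume : Measure ℝ))
      (symmDiff ((fun p => (p.1 + β k, p.2 + g k p.1)) ⁻¹' s) s)) atTop (𝓝 0) := by
  have hlim : Tendsto (fun k => shear (β k) (g k) (hg k)) atTop (𝓝 (ContinuousMap.id _)) := by
    rw [ContinuousMap.tendsto_iff_tendstoLocallyUniformly]
    refine TendstoUniformly.tendstoLocallyUniformly ?_
    rw [Metric.tendstoUniformly_iff]
    intro ε hε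
    have hβ' : ∀ᶠ k in atTop, ‖β k‖ < ε := by
      have := (tendsto_zero_iff_norm_tendsto_zero.1 hβ).eventually_lt_const hε
      exact this
    filter_upwards [hβ', hg0 ε hε] with k h1 h2 p
    rw [Prod.dist_eq]
    refine max_lt ?_ ?_
    · simpa [shear, dist_eq_norm] using h1
    · simpa [shear, Real.dist_eq] using h2 p.1
  have h := tendsto_measure_symmDiff_preimage_nhds_zero
    (μ := (volume : Measure (AddCircle L)).prod (volume : Measure ℝ))
    (ν := (volume : Measure (AddCircle L)).prod (volume : Measure ℝ)) (s := s) hlim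
    (Eventually.of_forall fun k => measurePreserving_shear (hg k)) (MeasurePreserving.id _)
    hs.nullMeasurableSet hs'
  exact h

end Cylinder

section Criterion

variable {L : ℝ} [hL : Fact (0 < L)] {F G : AddCircle L → ℝ} {α : AddCircle L} {n q : ℕ → ℕ}
  {E : Set (AddCircle L × ℝ)}

omit hL in
theorem continuous_birkhoffSum_rotation (hF : Continuous F) (m : ℕ) :
    Continuous (birkhoffSum (· + α) F m) := by
  have : ∀ j, Continuous ((fun y : AddCircle L => y + α)^[j]) :=
    fun j => (continuous_add_const α).iterate j
  unfold birkhoffSum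
  exact continuous_finsetSum _ fun j _ => hF.comp (this j)

/-- Almost every vertical translation by a limit value of Birkhoff sums preserves an invariant
set: the version along one phase `v` of the oscillation. -/
theorem tendsto_measure_window_phase (hF : Continuous F) (hG : Continuous G)
    (hq : Tendsto q atTop atTop) (hn : Tendsto (fun k => n k • α) atTop (𝓝 0))
    (hS : ∀ ε > 0, ∀ᶠ k in atTop, ∀ y, |birkhoffSum (· + α) F (n k) y - G (q k • y)| < ε)
    (hE : MeasurableSet E) (hinv : skewProduct (· + α) F ⁻¹' E = E) (M : ℝ) (v : AddCircle L) :
    Tendsto (fun k => (((volume : Measure (AddCircle L)).prod volume).restrict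
        (Set.univ ×ˢ Set.Icc (-M) M)) {p | ¬ ((p.1, p.2 + G (v + q k • p.1)) ∈ E ↔ p ∈ E)})
      atTop (𝓝 0) := by
  set μ : Measure (AddCircle L × ℝ) := (volume : Measure (AddCircle L)).prod volume with hμ
  obtain ⟨g₀, hg₀⟩ : ∃ g₀, ∀ y, |G y| ≤ g₀ := by
    obtain ⟨g₀, h⟩ := (isCompact_range hG).isBounded.exists_norm_le
    exact ⟨g₀, fun y => h _ ⟨y, rfl⟩⟩
  obtain ⟨r, rfl⟩ : ∃ r : ℝ, (r : AddCircle L) = v := QuotientAddGroup.mk_surjective v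
  set W : ℝ → Set (AddCircle L × ℝ) := fun M => Set.univ ×ˢ Set.Icc (-M) M with hW
  have hWm : ∀ M, MeasurableSet (W M) := fun M => MeasurableSet.univ.prod measurableSet_Icc
  have hWfin : ∀ M, μ (E ∩ W M) ≠ ⊤ := by
    intro M
    refine ne_top_of_le_ne_top ?_ (measure_mono Set.inter_subset_right)
    rw [hμ, hW, Measure.prod_prod]
    exact ENNReal.mul_ne_top (measure_ne_top _ _) (by simp)
  have hmemW : ∀ (M : ℝ) (p : AddCircle L × ℝ), p ∈ W M ↔ |p.2| ≤ M := by
    intro M p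
    simp [hW, abs_le]
  -- A shift of the base point by r / q tends to zero, yet moves the phase qy by exactly r.
  set β : ℕ → AddCircle L := fun k => ((r / q k : ℝ) : AddCircle L) with hβdef
  have hβ : Tendsto β atTop (𝓝 0) := by
    have h1 : Tendsto (fun k => r / (q k : ℝ)) atTop (𝓝 0) :=
      tendsto_const_nhds.div_atTop (tendsto_natCast_atTop_atTop.comp hq)
    have h2 := (AddCircle.continuous_mk' L).tendsto 0
    exact h2.comp h1
  have hqβ : ∀ᶠ k in atTop, q k • β k = (r : AddCircle L) := by
    filter_upwards [hq.eventually_gt_atTop 0] with k hk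
    have hk' : (q k : ℝ) ≠ 0 := by exact_mod_cast hk.ne'
    rw [hβdef, ← AddCircle.coe_nsmul, nsmul_eq_mul, mul_div_cancel₀ _ hk']
  set γ : ℕ → AddCircle L → ℝ := fun k y =>
    birkhoffSum (· + α) F (n k) (y + β k) - G ((r : AddCircle L) + q k • y) with hγdef
  have hcont : ∀ k, Continuous fun y : AddCircle L => (r : AddCircle L) + q k • y :=
    fun k => continuous_const.fun_add (continuous_nsmul (q k))
  have hγc : ∀ k, Continuous (γ k) := fun k =>
    ((continuous_birkhoffSum_rotation hF _).comp (continuous_add_const _)).sub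
      (hG.comp (hcont k))
  have hγ0 : ∀ ε > 0, ∀ᶠ k in atTop, ∀ y, |γ k y| < ε := by
    intro ε hε
    filter_upwards [hS ε hε, hqβ] with k h1 h2 y
    have := h1 (y + β k)
    rwa [smul_add, h2, add_comm (q k • y)] at this
  have hA := tendsto_measure_symmDiff_shear (g := fun _ _ => 0) (fun _ => continuous_const) hβ
    (fun ε hε => Eventually.of_forall fun k y => by simpa using hε) (hE.inter (hWm M)) (hWfin M)
  have hβn : Tendsto (fun k => β k + n k • α) atTop (𝓝 0) := by simpa using hβ.add hn
  -- The window is enlarged by g₀ for the translation by G and by 1 for the error γ.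
  have hD := tendsto_measure_symmDiff_shear hγc hβn hγ0 (hE.inter (hWm (M + g₀ + 1)))
    (hWfin (M + g₀ + 1))
  have hsum := hA.add hD
  rw [add_zero] at hsum
  refine tendsto_of_tendsto_of_tendsto_of_le_of_le' tendsto_const_nhds hsum
    (Eventually.of_forall fun k => zero_le) ?_
  filter_upwards [hγ0 1 one_pos] with k hk
  set C : AddCircle L × ℝ → AddCircle L × ℝ :=
    fun p => (p.1 + 0, p.2 + G ((r : AddCircle L) + q k • p.1)) with hC
  have hCm : MeasurePreserving C μ μ := measurePreserving_shear
    (hG.comp (hcont k))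
  have hDm : Measurable fun p : AddCircle L × ℝ => (p.1 + (β k + n k • α), p.2 + γ k p.1) :=
    (measurePreserving_shear (hγc k)).measurable
  rw [← hCm.measure_preimage (((hDm (hE.inter (hWm _))).symmDiff
    (hE.inter (hWm _))).nullMeasurableSet)]
  rw [Measure.restrict_apply' (hWm M)]
  refine (measure_mono ?_).trans (measure_union_le _ _)
  rintro ⟨y, t⟩ ⟨hne, ht⟩
  have ht' := (hmemW _ _).1 ht
  have hCW : |t + G ((r : AddCircle L) + q k • y)| ≤ M + g₀ + 1 := by
    have := abs_add_le t (G ((r : AddCircle L) + q k • y))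
    have := hg₀ ((r : AddCircle L) + q k • y)
    simp only at ht'
    linarith
  have hDW : |t + G ((r : AddCircle L) + q k • y) + γ k y| ≤ M + g₀ + 1 := by
    have := abs_add_le t (G ((r : AddCircle L) + q k • y))
    have := hg₀ ((r : AddCircle L) + q k • y)
    have := abs_add_le (t + G ((r : AddCircle L) + q k • y)) (γ k y)
    have := hk y
    simp only at ht'
    linarith
  -- The small shear with error γ, applied after the vertical translation by G, is the n-th iterate
  -- started at the shifted point (y + β, t). So invariance of E relates the two.
  have horb : (y + (β k + n k • α), t + G ((r : AddCircle L) + q k • y) + γ k y) ∈ E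
      ↔ (y + β k, t) ∈ E := by
    have h1 : (skewProduct (· + α) F)^[n k] ⁻¹' E = E :=
      Set.preimage_iterate_eq ▸ Function.iterate_fixed hinv (n k)
    conv_rhs => rw [← h1]
    rw [Set.mem_preimage, skewProduct_iterate, add_right_iterate]
    simp only [hγdef]
    rw [add_assoc y, add_assoc t, add_sub_cancel]
  have hw1 := (hmemW (M + g₀ + 1) (y, t + G ((r : AddCircle L) + q k • y))).2 hCW
  have hw2 := (hmemW (M + g₀ + 1)
    (y + (β k + n k • α), t + G ((r : AddCircle L) + q k • y) + γ k y)).2 hDW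
  have hw3 : (y + β k, t) ∈ W M := (hmemW _ _).2 ht'
  simp only [Set.mem_ofPred_eq] at hne
  by_cases hA : (y + β k, t) ∈ E ↔ (y, t) ∈ E
  · right
    simp only [hC, Set.mem_preimage, Set.mem_symmDiff, Set.mem_inter_iff, add_zero, hw1, hw2,
      horb, hA, and_true]
    tauto
  · left
    simp only [Set.mem_preimage, Set.mem_symmDiff, Set.mem_inter_iff, add_zero, ht, hw3,
      and_true]
    tauto

end Criterion

section Criterion

variable {L : ℝ} [hL : Fact (0 < L)] {F G : AddCircle L → ℝ} {α : AddCircle L} {n q : ℕ → ℕ}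
  {E : Set (AddCircle L × ℝ)}

theorem measurableSet_not_iff {X Y : Type*} [MeasurableSpace X] [MeasurableSpace Y]
    {E : Set Y} (hE : MeasurableSet E) {f g : X → Y} (hf : Measurable f) (hg : Measurable g) :
    MeasurableSet {x | ¬ (f x ∈ E ↔ g x ∈ E)} := by
  have : {x | ¬ (f x ∈ E ↔ g x ∈ E)} = symmDiff (f ⁻¹' E) (g ⁻¹' E) := by
    ext x
    simp only [Set.mem_ofPred_eq, Set.mem_symmDiff, Set.mem_preimage]
    tauto
  rw [this]
  exact (hf hE).symmDiff (hg hE)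

/-- If Birkhoff sums along a rigidity sequence look like `G (q y)` with `q → ∞`, then an
invariant set is almost invariant under the vertical translation by almost every value of `G`. -/
theorem ae_translation_invariant (hF : Continuous F) (hG : Continuous G)
    (hq : Tendsto q atTop atTop) (hn : Tendsto (fun k => n k • α) atTop (𝓝 0))
    (hS : ∀ ε > 0, ∀ᶠ k in atTop, ∀ y, |birkhoffSum (· + α) F (n k) y - G (q k • y)| < ε)
    (hE : MeasurableSet E) (hinv : skewProduct (· + α) F ⁻¹' E = E) :
    ∀ᵐ u : AddCircle L, ((volume : Measure (AddCircle L)).prod (volume : Measure ℝ))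
      {p | ¬ ((p.1, p.2 + G u) ∈ E ↔ p ∈ E)} = 0 := by
  set μ : Measure (AddCircle L × ℝ) := (volume : Measure (AddCircle L)).prod volume with hμ
  have hwin : ∀ M : ℕ, ∀ᵐ u : AddCircle L, (μ.restrict (Set.univ ×ˢ Set.Icc (-(M : ℝ)) M))
      {p | ¬ ((p.1, p.2 + G u) ∈ E ↔ p ∈ E)} = 0 := by
    intro M
    set κ := μ.restrict (Set.univ ×ˢ Set.Icc (-(M : ℝ)) M) with hκ
    have hfin : IsFiniteMeasure κ := by
      refine ⟨?_⟩
      rw [hκ, Measure.restrict_apply_univ, hμ, Measure.prod_prod]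
      exact ENNReal.mul_lt_top (measure_lt_top _ _) (by simp)
    set S : Set ((AddCircle L × ℝ) × AddCircle L) :=
      {x | ¬ ((x.1.1, x.1.2 + G x.2) ∈ E ↔ x.1 ∈ E)} with hSdef
    have hGm : Measurable G := hG.measurable
    have hSm : MeasurableSet S := measurableSet_not_iff hE (by fun_prop) (by fun_prop)
    -- Shearing the phase u by qy preserves the product measure. The measure of S is therefore, for
    -- every k, the integral over phases v of a quantity tending to 0, and so it is 0.
    let θ : ℕ → (AddCircle L × ℝ) × AddCircle L → (AddCircle L × ℝ) × AddCircle L :=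
      fun k x => (x.1, x.2 + q k • x.1.1)
    have hθ : ∀ k, MeasurePreserving (θ k) (κ.prod volume) (κ.prod volume) := by
      intro k
      have hc : Measurable fun y : AddCircle L => q k • y := (continuous_nsmul (q k)).measurable
      refine (MeasurePreserving.id κ).skew_product (g := fun p u => u + q k • p.1) ?_
        (Eventually.of_forall fun p => (measurePreserving_add_right volume _).map_eq)
      exact measurable_snd.add (hc.comp (measurable_fst.comp measurable_fst))
    have hval : ∀ k, (κ.prod volume) S = ∫⁻ v : AddCircle L,
        κ {p | ¬ ((p.1, p.2 + G (v + q k • p.1)) ∈ E ↔ p ∈ E)} := by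
      intro k
      rw [← (hθ k).measure_preimage hSm.nullMeasurableSet,
        Measure.prod_apply_symm ((hθ k).measurable hSm)]
      rfl
    have hlim : Tendsto (fun k => ∫⁻ v : AddCircle L,
        κ {p | ¬ ((p.1, p.2 + G (v + q k • p.1)) ∈ E ↔ p ∈ E)}) atTop
        (𝓝 (∫⁻ _ : AddCircle L, 0)) := by
      refine tendsto_lintegral_of_dominated_convergence (fun _ => κ Set.univ)
        (fun k => measurable_measure_prodMk_right ((hθ k).measurable hSm))
        (fun k => Eventually.of_forall fun v => measure_mono (Set.subset_univ _)) ?_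
        (Eventually.of_forall fun v =>
          tendsto_measure_window_phase hF hG hq hn hS hE hinv M v)
      rw [lintegral_const]
      exact ENNReal.mul_ne_top (measure_ne_top _ _) (measure_ne_top _ _)
    have h0 : (κ.prod volume) S = 0 := by
      have h1 : Tendsto (fun _ : ℕ => (κ.prod volume) S) atTop (𝓝 0) := by
        simpa only [← hval, lintegral_zero] using hlim
      exact tendsto_nhds_unique tendsto_const_nhds h1
    rw [Measure.prod_apply_symm hSm, lintegral_eq_zero_iff
      (measurable_measure_prodMk_right hSm)] at h0
    exact h0
  rw [← ae_all_iff] at hwin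
  filter_upwards [hwin] with u hu
  set s := {p : AddCircle L × ℝ | ¬ ((p.1, p.2 + G u) ∈ E ↔ p ∈ E)} with hs
  have hcov : s ⊆ ⋃ M : ℕ, s ∩ (Set.univ ×ˢ Set.Icc (-(M : ℝ)) M) := by
    intro p hp
    obtain ⟨M, hM⟩ := exists_nat_ge |p.2|
    refine Set.mem_iUnion.2 ⟨M, hp, ?_⟩
    simpa [← abs_le] using hM
  refine measure_mono_null hcov (measure_iUnion_null fun M => ?_)
  have := hu M
  rwa [Measure.restrict_apply' (MeasurableSet.univ.prod measurableSet_Icc)] at this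

/-- A criterion for the ergodicity of a skew product over an irrational rotation. -/
theorem preErgodic_skewProduct_rotation (hF : Continuous F) (hG : Continuous G)
    (hα : addOrderOf α = 0) (hG0 : ∀ ε > 0, ∃ u, 0 < |G u| ∧ |G u| < ε)
    (hq : Tendsto q atTop atTop) (hn : Tendsto (fun k => n k • α) atTop (𝓝 0))
    (hS : ∀ ε > 0, ∀ᶠ k in atTop, ∀ y, |birkhoffSum (· + α) F (n k) y - G (q k • y)| < ε) :
    PreErgodic (skewProduct (· + α) F) ((volume : Measure (AddCircle L)).prod volume) := by
  refine ⟨fun E hE hinv => ?_⟩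
  have hae := ae_translation_invariant hF hG hq hn hS hE hinv
  have hex : ∀ j : ℕ, ∃ c : ℝ, 0 < |c| ∧ |c| < 1 / ((j : ℝ) + 1) ∧
      ((volume : Measure (AddCircle L)).prod (volume : Measure ℝ))
        {p | ¬ ((p.1, p.2 + c) ∈ E ↔ p ∈ E)} = 0 := by
    intro j
    have ho : IsOpen {u | 0 < |G u| ∧ |G u| < 1 / ((j : ℝ) + 1)} :=
      (isOpen_lt continuous_const hG.abs).inter (isOpen_lt hG.abs continuous_const)
    -- Only almost every u gives a translation; these are dense, hence meet the open set of small
    -- nonzero values of G.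
    obtain ⟨u, ⟨h1, h2⟩, h3⟩ := (Measure.dense_of_ae hae).inter_open_nonempty _ ho
      (hG0 _ (by positivity))
    exact ⟨G u, h1, h2, h3⟩
  choose c hc0 hc1 hc2 using hex
  have hfib : ∀ᵐ y : AddCircle L, EventuallyConst (Prod.mk y ⁻¹' E) (ae (volume : Measure ℝ)) := by
    have h1 : ∀ᵐ y : AddCircle L, ∀ j, ∀ᵐ t : ℝ, ((y, t + c j) ∈ E ↔ (y, t) ∈ E) := by
      rw [ae_all_iff]
      intro j
      filter_upwards [Measure.measure_ae_null_of_prod_null (hc2 j)] with y hy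
      exact hy
    filter_upwards [h1] with y hy
    refine eventuallyConst_of_small_ae_periods (measurable_prodMk_left hE) fun ε hε => ?_
    obtain ⟨j, hj⟩ := exists_nat_one_div_lt hε
    exact ⟨c j, hc0 j, (hc1 j).trans hj, hy j⟩
  -- The set of y with null fibre is invariant under the rotation; outside it almost every fibre is
  -- conull.
  set D : Set (AddCircle L) := {y | (volume : Measure ℝ) (Prod.mk y ⁻¹' E) = 0} with hD
  have hDm : MeasurableSet D := measurable_measure_prodMk_left hE (measurableSet_singleton 0)
  have hDinv : (· + α) ⁻¹' D = D := by
    ext y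
    have h1 : Prod.mk y ⁻¹' E = (· + F y) ⁻¹' (Prod.mk (y + α) ⁻¹' E) := by
      conv_lhs => rw [← hinv]
      rfl
    simp only [hD, Set.mem_preimage, Set.mem_ofPred_eq]
    rw [h1, measure_preimage_add_right]
  have herg : Ergodic (fun y : AddCircle L => y + α) := AddCircle.ergodic_add_right.2 hα
  rw [eventuallyConst_set]
  rcases eventuallyConst_set.1 (herg.aeconst_set hDm hDinv) with h | h
  · right
    rw [ae_iff]
    simp only [not_not]
    change ((volume : Measure (AddCircle L)).prod (volume : Measure ℝ)) E = 0
    rw [Measure.measure_prod_null hE]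
    exact h
  · left
    change ((volume : Measure (AddCircle L)).prod (volume : Measure ℝ)) Eᶜ = 0
    rw [Measure.measure_prod_null hE.compl]
    filter_upwards [h, hfib] with y h1 h2
    rcases eventuallyConst_set.1 h2 with h3 | h3
    · exact h3
    · refine absurd ?_ h1
      rw [ae_iff] at h3
      simp only [not_not] at h3
      exact h3

end Criterion

/-! ### Birkhoff sums over rational rotations. -/

theorem two_mul_sin_half_mul_sum_sin (a d : ℝ) (M : ℕ) :
    2 * Real.sin (d / 2) * ∑ j ∈ Finset.range M, Real.sin (a + j * d)
      = Real.cos (a - d / 2) - Real.cos (a + (M - 1 / 2) * d) := by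
  induction M with
  | zero => simp; ring_nf
  | succ M ih =>
    rw [Finset.sum_range_succ, mul_add, ih]
    have h1 : a + ((M + 1 : ℕ) - 1 / 2 : ℝ) * d = (a + M * d) + d / 2 := by push_cast; ring
    have h2 : a + ((M : ℝ) - 1 / 2) * d = (a + M * d) - d / 2 := by ring
    rw [h1, h2, Real.cos_add (a + M * d), Real.cos_sub (a + M * d)]
    ring

/-- Linearizes the closed form of the grid sums: with h of order 1/q, the quadratic error is still
O(1/q) after multiplication by q. -/
theorem abs_sin_div_cos_sub_le {z h : ℝ} (hz : |z| ≤ h) (h1 : h ≤ 1) :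
    |Real.sin z / Real.cos h - z| ≤ 4 * h ^ 2 := by
  have h0 : 0 ≤ h := (abs_nonneg z).trans hz
  have hc := Real.one_sub_sq_div_two_le_cos (x := h)
  have hc' := Real.cos_le_one h
  have hcpos : 1 / 2 ≤ Real.cos h := by nlinarith
  have hs := abs_le.1 (Real.sin_bound (hz.trans h1))
  have hz2 : |z| ^ 2 ≤ h ^ 2 := pow_le_pow_left₀ (abs_nonneg z) hz 2
  have hz3 : |z| ^ 3 ≤ h ^ 2 := by
    have : |z| ^ 3 = |z| ^ 2 * |z| := by ring
    nlinarith [abs_nonneg z, sq_nonneg |z|]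
  have hz4 : |z| ^ 4 ≤ h ^ 2 := by
    have : |z| ^ 4 = |z| ^ 3 * |z| := by ring
    nlinarith [abs_nonneg z, pow_nonneg (abs_nonneg z) 3]
  have hz5 : |z| ^ 5 ≤ h ^ 2 := by
    have : |z| ^ 5 = |z| ^ 4 * |z| := by ring
    nlinarith [abs_nonneg z, pow_nonneg (abs_nonneg z) 4]
  have hz3' := abs_le.1 (le_of_eq_of_le (abs_pow z 3) hz3)
  have hsin : |Real.sin z - z| ≤ h ^ 2 := by
    rw [abs_le]; constructor <;> linarith [hs.1, hs.2, hz3'.1, hz3'.2]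
  have hzc : |z * (1 - Real.cos h)| ≤ h ^ 2 := by
    rw [abs_mul, abs_of_nonneg (by linarith : (0 : ℝ) ≤ 1 - Real.cos h)]
    nlinarith [abs_nonneg z]
  have e : Real.sin z / Real.cos h - z
      = ((Real.sin z - z) + z * (1 - Real.cos h)) / Real.cos h := by
    field_simp
    ring
  rw [e, abs_div, abs_of_pos (by linarith : 0 < Real.cos h), div_le_iff₀ (by linarith)]
  have := abs_add_le (Real.sin z - z) (z * (1 - Real.cos h))
  nlinarith [sq_nonneg h]

/-- The tent function that is the limit of the renormalized Birkhoff sums. -/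
noncomputable def tent (L w : ℝ) : ℝ := Real.pi * (L / 4 - |w - L / 2|)

section RationalSums

variable {L : ℝ} [hL : Fact (0 < L)]

/-- Either N + 1 or N sample points fall in `[0, 1)`, according to whether qx is below L/2. A full
turn is N + 1/2 grid steps, so the telescoped sine sum misses closing up by half a step, over or
under. The two closed forms linearize to the two slopes of the tent. -/
theorem circleSin_sum_sub_tent_le (h1 : 1 ≤ L) {q N : ℕ} (hqN : (q : ℝ) = (N + 1 / 2) * L)
    (hq : Real.pi * L ≤ 2 * q) {x : ℝ} (hx0 : 0 ≤ x) (hx : x < L / q) :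
    |q * ∑ j ∈ Finset.range q, circleSin L ((x + j * (L / q) : ℝ) : AddCircle L)
      - tent L (q * x)| ≤ Real.pi ^ 2 * L ^ 2 / (2 * q) := by
  have hπ := Real.pi_pos
  have hLpos : 0 < L := hL.out
  have hqpos : (0 : ℝ) < q := by rw [hqN]; positivity
  have hw : q * x < L := by rwa [lt_div_iff₀ hqpos, mul_comm] at hx
  have hNq : N < q := by
    have : (N : ℝ) < q := by rw [hqN]; nlinarith [(Nat.cast_nonneg N : (0 : ℝ) ≤ N)]
    exact_mod_cast this
  -- A quarter of the phase advance 2πL/q between neighbouring sample points.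
  set h := Real.pi * L / (2 * q) with hh
  have hpos : 0 < h := by positivity
  have hle : h ≤ 1 := by rw [hh, div_le_one (by positivity)]; exact hq
  have hqh : q * h = Real.pi * L / 2 := by rw [hh]; field_simp
  have h2π : ((N : ℝ) + 1 / 2) * (4 * h) = 2 * Real.pi := by
    have : (q : ℝ) * (((N : ℝ) + 1 / 2) * (4 * h)) = q * (2 * Real.pi) := by
      calc _ = ((N : ℝ) + 1 / 2) * 4 * (q * h) := by ring
        _ = 2 * Real.pi * (((N : ℝ) + 1 / 2) * L) := by rw [hqh]; ring
        _ = _ := by rw [← hqN]; ring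
    exact mul_left_cancel₀ hqpos.ne' this
  have hsinpos : 0 < Real.sin h := Real.sin_pos_of_pos_of_lt_pi hpos (by linarith [Real.pi_gt_three])
  have hcospos : 0 < Real.cos h :=
    Real.cos_pos_of_mem_Ioo ⟨by linarith, by linarith [Real.pi_gt_three]⟩
  have hsum : ∀ M : ℕ, M ≤ q → (∀ j : ℕ, j < M → q * x + j * L < q) →
      (∀ j : ℕ, M ≤ j → (q : ℝ) ≤ q * x + j * L) →
      ∑ j ∈ Finset.range q, circleSin L ((x + j * (L / q) : ℝ) : AddCircle L)
        = ∑ j ∈ Finset.range M, Real.sin (2 * Real.pi * x + j * (4 * h)) := by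
    intro M hM hlt hge
    have hscale : ∀ j : ℕ, q * x + j * L = q * (x + j * (L / q)) := by
      intro j; field_simp
    rw [← Finset.sum_subset (Finset.range_mono hM)]
    · refine Finset.sum_congr rfl fun j hj => ?_
      have h3 := hlt j (Finset.mem_range.1 hj)
      rw [hscale] at h3
      rw [circleSin_of_lt_one h1 (by positivity) (by nlinarith)]
      congr 1
      rw [hh]; field_simp; ring
    · intro j hj hj'
      have hj1 : j < q := Finset.mem_range.1 hj
      have h3 := hge j (not_lt.1 fun hlt' => hj' (Finset.mem_range.2 hlt'))
      rw [hscale] at h3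
      refine circleSin_of_one_le (by nlinarith) ?_
      have h4 : (j : ℝ) + 1 ≤ q := by exact_mod_cast hj1
      have h5 : q * (x + j * (L / q)) < q * L := by
        rw [← hscale]; nlinarith
      exact lt_of_mul_lt_mul_left h5 hqpos.le
  have hbound : ∀ z : ℝ, |z| ≤ h →
      |q / 2 * (Real.sin z / Real.cos h - z)| ≤ Real.pi ^ 2 * L ^ 2 / (2 * q) := by
    intro z hz
    rw [abs_mul, abs_of_pos (by positivity : (0 : ℝ) < q / 2)]
    have h3 := mul_le_mul_of_nonneg_left (abs_sin_div_cos_sub_le hz hle)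
      (by positivity : (0 : ℝ) ≤ q / 2)
    refine h3.trans (le_of_eq ?_)
    rw [hh]; field_simp; ring
  have hzq : q * (2 * Real.pi * x) = 2 * Real.pi * (q * x) := by ring
  rcases lt_or_ge (q * x) (L / 2) with hc | hc
  · have hS := two_mul_sin_half_mul_sum_sin (2 * Real.pi * x) (4 * h) (N + 1)
    rw [← hsum (N + 1) hNq ?_ ?_] at hS
    · set A := ∑ j ∈ Finset.range q, circleSin L ((x + j * (L / q) : ℝ) : AddCircle L)
      have e1 : 2 * Real.pi * x + (((N + 1 : ℕ) : ℝ) - 1 / 2) * (4 * h)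
          = 2 * Real.pi * x + 2 * Real.pi := by rw [← h2π]; push_cast; ring
      have e2 : Real.cos (2 * Real.pi * x - 4 * h / 2) - Real.cos (2 * Real.pi * x)
          = 2 * Real.sin h * Real.sin (2 * Real.pi * x - h) := by
        rw [Real.cos_sub_cos]
        have : (2 * Real.pi * x - 4 * h / 2 - 2 * Real.pi * x) / 2 = -h := by ring
        rw [this, Real.sin_neg]
        have : (2 * Real.pi * x - 4 * h / 2 + 2 * Real.pi * x) / 2 = 2 * Real.pi * x - h := by ring
        rw [this]; ring
      rw [e1, Real.cos_add_two_pi, e2, show 4 * h / 2 = 2 * h by ring, Real.sin_two_mul] at hS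
      have hval : A = Real.sin (2 * Real.pi * x - h) / (2 * Real.cos h) := by
        rw [eq_div_iff (by positivity)]
        have : 2 * Real.sin h * (A * (2 * Real.cos h))
          = 2 * Real.sin h * Real.sin (2 * Real.pi * x - h) := by rw [← hS]; ring
        exact mul_left_cancel₀ (by positivity) this
      have ht : tent L (q * x) = q / 2 * (2 * Real.pi * x - h) := by
        rw [tent, abs_of_neg (by linarith)]
        have : q / 2 * (2 * Real.pi * x - h) = Real.pi * (q * x) - q * h / 2 := by ring
        rw [this, hqh]; ring
      have hz : |2 * Real.pi * x - h| ≤ h := by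
        rw [abs_le]
        refine ⟨by nlinarith [mul_nonneg hπ.le hx0], ?_⟩
        have : q * (2 * Real.pi * x) ≤ q * (2 * h) := by
          rw [hzq]; nlinarith
        linarith [le_of_mul_le_mul_left this hqpos]
      have := hbound _ hz
      rw [ht, hval]
      convert this using 2
      field_simp
    · intro j hj
      have : (j : ℝ) ≤ N := by exact_mod_cast Nat.lt_succ_iff.1 hj
      rw [hqN]; rw [hqN] at hc; nlinarith
    · intro j hj
      have : (N : ℝ) + 1 ≤ j := by exact_mod_cast hj
      have h5 := mul_nonneg hqpos.le hx0
      have h6 : ((N : ℝ) + 1) * L ≤ j * L := mul_le_mul_of_nonneg_right this hLpos.le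
      linarith
  · have hS := two_mul_sin_half_mul_sum_sin (2 * Real.pi * x) (4 * h) N
    rw [← hsum N hNq.le ?_ ?_] at hS
    · set A := ∑ j ∈ Finset.range q, circleSin L ((x + j * (L / q) : ℝ) : AddCircle L)
      have e1 : 2 * Real.pi * x + ((N : ℝ) - 1 / 2) * (4 * h)
          = (2 * Real.pi * x - 4 * h) + 2 * Real.pi := by rw [← h2π]; ring
      have e2 : Real.cos (2 * Real.pi * x - 4 * h / 2) - Real.cos (2 * Real.pi * x - 4 * h)
          = 2 * Real.sin h * -Real.sin (2 * Real.pi * x - 3 * h) := by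
        rw [Real.cos_sub_cos]
        have : (2 * Real.pi * x - 4 * h / 2 - (2 * Real.pi * x - 4 * h)) / 2 = h := by ring
        rw [this]
        have : (2 * Real.pi * x - 4 * h / 2 + (2 * Real.pi * x - 4 * h)) / 2
          = 2 * Real.pi * x - 3 * h := by ring
        rw [this]; ring
      rw [e1, Real.cos_add_two_pi, e2, show 4 * h / 2 = 2 * h by ring, Real.sin_two_mul] at hS
      have hval : A = -Real.sin (2 * Real.pi * x - 3 * h) / (2 * Real.cos h) := by
        rw [eq_div_iff (by positivity)]
        have : 2 * Real.sin h * (A * (2 * Real.cos h))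
          = 2 * Real.sin h * -Real.sin (2 * Real.pi * x - 3 * h) := by rw [← hS]; ring
        exact mul_left_cancel₀ (by positivity) this
      have ht : tent L (q * x) = -(q / 2 * (2 * Real.pi * x - 3 * h)) := by
        rw [tent, abs_of_nonneg (by linarith)]
        have : -(q / 2 * (2 * Real.pi * x - 3 * h)) = 3 * (q * h) / 2 - Real.pi * (q * x) := by
          ring
        rw [this, hqh]; ring
      have hz : |2 * Real.pi * x - 3 * h| ≤ h := by
        rw [abs_le]
        constructor
        · have : q * (2 * h) ≤ q * (2 * Real.pi * x) := by
            rw [hzq]; nlinarith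
          linarith [le_of_mul_le_mul_left this hqpos]
        · have : q * (2 * Real.pi * x) ≤ q * (4 * h) := by
            rw [hzq]; nlinarith
          linarith [le_of_mul_le_mul_left this hqpos]
      have := hbound _ hz
      rw [ht, hval]
      rw [← abs_neg] at this
      convert this using 2
      field_simp
      ring
    · intro j hj
      have : (j : ℝ) + 1 ≤ N := by exact_mod_cast hj
      have h6 : ((j : ℝ) + 1) * L ≤ N * L := mul_le_mul_of_nonneg_right this hLpos.le
      linarith
    · intro j hj
      have : (N : ℝ) ≤ j := by exact_mod_cast hj
      have h6 : (N : ℝ) * L ≤ j * L := mul_le_mul_of_nonneg_right this hLpos.le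
      linarith

/-- The embedding of `ℤ/q` in the circle as the points of order dividing `q`. -/
noncomputable def torsionHom (L : ℝ) (q : ℕ) [NeZero q] : ZMod q →+ AddCircle L :=
  ZMod.lift q ⟨zmultiplesHom (AddCircle L) ((L / q : ℝ) : AddCircle L), by
    have hq : (q : ℝ) ≠ 0 := NeZero.ne _
    rw [zmultiplesHom_apply, ← AddCircle.coe_zsmul, zsmul_eq_mul, Int.cast_natCast,
      mul_div_cancel₀ _ hq, AddCircle.coe_period]⟩

omit hL in
theorem torsionHom_intCast (q : ℕ) [NeZero q] (k : ℤ) :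
    torsionHom L q (k : ZMod q) = ((k * (L / q) : ℝ) : AddCircle L) := by
  rw [torsionHom, ZMod.lift_coe]
  simp [zmultiplesHom_apply]

theorem sum_range_natCast_zmod {M : Type*} [AddCommMonoid M] (q : ℕ) [NeZero q] (g : ZMod q → M) :
    ∑ j ∈ Finset.range q, g (j : ZMod q) = ∑ z, g z := by
  refine Finset.sum_nbij' (fun j => (j : ZMod q)) ZMod.val ?_ ?_ ?_ ?_ ?_
  · simp
  · intro z _; exact Finset.mem_range.2 (ZMod.val_lt z)
  · intro j hj; exact ZMod.val_cast_of_lt (Finset.mem_range.1 hj)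
  · intro z _; exact ZMod.natCast_zmod_val z
  · simp

theorem sum_range_mul_natCast_zmod (q m : ℕ) [NeZero q] (g : ZMod q → ℝ) :
    ∑ j ∈ Finset.range (m * q), g (j : ZMod q) = m * ∑ z, g z := by
  induction m with
  | zero => simp
  | succ m ih =>
    rw [Nat.succ_mul, Finset.sum_range_add, ih, ← sum_range_natCast_zmod q g]
    simp only [Nat.cast_add, Nat.cast_mul, CharP.cast_eq_zero, mul_zero, zero_add]
    push_cast; ring

omit hL in
-- As p is a unit, q² steps visit each point of the coset of q-torsion exactly q times, wherever in
-- the coset they start. The extra factor q brings a deviation of order 1/q up to order 1.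
theorem birkhoffSum_rational (F : AddCircle L → ℝ) {q : ℕ} [NeZero q] {p : ℤ}
    (hp : IsUnit (p : ZMod q)) (y : AddCircle L) (i : ℤ) :
    birkhoffSum (· + ((p * (L / q) : ℝ) : AddCircle L)) F (q * q)
        (y + ((i * (L / q) : ℝ) : AddCircle L))
      = q * ∑ j ∈ Finset.range q, F (y + ((j * (L / q) : ℝ) : AddCircle L)) := by
  have h1 : ∀ j : ℕ, ((j * (L / q) : ℝ) : AddCircle L) = torsionHom L q (j : ZMod q) := by
    intro j
    have := torsionHom_intCast (L := L) q (j : ℤ)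
    push_cast at this
    exact this.symm
  simp only [birkhoffSum, add_right_iterate, h1, ← torsionHom_intCast]
  rw [sum_range_natCast_zmod q (fun z => F (y + torsionHom L q z))]
  have h2 : ∀ j : ℕ, F (y + torsionHom L q (i : ZMod q) + j • torsionHom L q (p : ZMod q))
      = F (y + torsionHom L q ((i : ZMod q) + (j : ZMod q) * p)) := by
    intro j
    rw [map_add, ← nsmul_eq_mul, map_nsmul, add_assoc]
  simp only [h2]
  rw [sum_range_mul_natCast_zmod q q
    (fun z => F (y + torsionHom L q ((i : ZMod q) + z * p)))]
  congr 1
  obtain ⟨u, hu⟩ := hp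
  rw [← hu]
  exact Fintype.sum_equiv ((Units.mulRight u).trans (Equiv.addLeft (i : ZMod q))) _ _
    (fun z => rfl)

/-- The tent function on the circle. -/
noncomputable def circleTent (L : ℝ) [Fact (0 < L)] : AddCircle L → ℝ :=
  AddCircle.liftIco L 0 (tent L)

theorem continuous_circleTent : Continuous (circleTent L) := by
  have hL0 : 0 < L := hL.out
  refine AddCircle.liftIco_zero_continuous ?_ (by unfold tent; fun_prop)
  rw [tent, tent, abs_of_neg (by linarith), abs_of_pos (by linarith)]
  ring

theorem circleTent_small {ε : ℝ} (hε : 0 < ε) :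
    ∃ u : AddCircle L, 0 < |circleTent L u| ∧ |circleTent L u| < ε := by
  have hL0 : 0 < L := hL.out
  have hπ := Real.pi_pos
  -- The tent vanishes at L/4 with slope π there, so the point L/4 + δ has value πδ.
  set δ := min (ε / (2 * Real.pi)) (L / 8) with hδ
  have hδ0 : 0 < δ := by positivity
  have hδ1 : δ ≤ L / 8 := min_le_right _ _
  have hδ2 : Real.pi * δ < ε := by
    have : δ ≤ ε / (2 * Real.pi) := min_le_left _ _
    rw [le_div_iff₀ (by positivity)] at this
    linarith
  have hv : circleTent L ((L / 4 + δ : ℝ) : AddCircle L) = Real.pi * δ := by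
    rw [circleTent, AddCircle.liftIco_zero_coe_apply ⟨by linarith, by linarith⟩, tent,
      abs_of_neg (by linarith)]
    ring
  refine ⟨((L / 4 + δ : ℝ) : AddCircle L), ?_⟩
  rw [hv, abs_of_pos (by positivity)]
  exact ⟨by positivity, hδ2⟩

/-- Subtracting a multiple of L/q changes neither the sum over the coset nor q • y, so y may be
taken in `[0, L/q)`. -/
theorem birkhoffSum_circleSin_sub_tent_le (h1 : 1 ≤ L) {q N : ℕ} [NeZero q]
    (hqN : (q : ℝ) = (N + 1 / 2) * L) (hq : Real.pi * L ≤ 2 * q) {p : ℤ}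
    (hp : IsUnit (p : ZMod q)) (y : AddCircle L) :
    |birkhoffSum (· + ((p * (L / q) : ℝ) : AddCircle L)) (circleSin L) (q * q) y
      - circleTent L (q • y)| ≤ Real.pi ^ 2 * L ^ 2 / (2 * q) := by
  have hLpos : 0 < L := hL.out
  have hqpos : (0 : ℝ) < q := by exact_mod_cast Nat.pos_of_ne_zero (NeZero.ne q)
  obtain ⟨w, rfl⟩ : ∃ r : ℝ, (r : AddCircle L) = y := QuotientAddGroup.mk_surjective y
  set i := ⌊w / (L / q)⌋ with hi
  set x := w - i * (L / q) with hx
  have hd : 0 < L / q := by positivity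
  have h3 := Int.floor_le (w / (L / q))
  have h4 := Int.lt_floor_add_one (w / (L / q))
  rw [← hi, le_div_iff₀ hd] at h3
  rw [← hi, div_lt_iff₀ hd] at h4
  have hx0 : 0 ≤ x := by linarith
  have hx1 : x < L / q := by linarith
  have hw : (w : AddCircle L) = (x : AddCircle L) + ((i * (L / q) : ℝ) : AddCircle L) := by
    rw [← AddCircle.coe_add]; congr 1; ring
  have hqx : q * x < L := by rwa [lt_div_iff₀ hqpos, mul_comm] at hx1
  have ht : circleTent L (q • (w : AddCircle L)) = tent L (q * x) := by
    have : q • (w : AddCircle L) = ((q * x : ℝ) : AddCircle L) := by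
      rw [hw, smul_add, ← AddCircle.coe_nsmul, ← AddCircle.coe_nsmul, nsmul_eq_mul, nsmul_eq_mul]
      have : (q : ℝ) * (i * (L / q)) = i • L := by rw [zsmul_eq_mul]; field_simp
      rw [this, AddCircle.coe_zsmul, AddCircle.coe_period, smul_zero, add_zero]
    rw [this, circleTent, AddCircle.liftIco_zero_coe_apply ⟨by positivity, hqx⟩]
  rw [ht, hw, birkhoffSum_rational _ hp]
  have := circleSin_sum_sub_tent_le h1 hqN hq hx0 hx1
  simpa only [AddCircle.coe_add] using this

end RationalSums

/-! ### Generic angles by Baire category. -/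

section Generic

variable {L : ℝ} [hL : Fact (0 < L)]

omit hL in
theorem continuous_birkhoffSum_angle {F : AddCircle L → ℝ} (hF : Continuous F) (n : ℕ) :
    Continuous fun x : ℝ × AddCircle L =>
      birkhoffSum (· + ((x.1 * L : ℝ) : AddCircle L)) F n x.2 := by
  simp only [birkhoffSum, add_right_iterate]
  refine continuous_finsetSum _ fun j _ => hF.comp ?_
  have h : Continuous fun x : ℝ × AddCircle L => ((x.1 * L : ℝ) : AddCircle L) :=
    (AddCircle.continuous_mk' L).comp (by fun_prop)
  exact continuous_snd.fun_add ((continuous_nsmul j).comp h)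

/-- The Birkhoff sums of length `9 ^ m` as functions on the circle, depending on the angle. -/
noncomputable def birkhoffCurve (h1 : 1 ≤ L) (m : ℕ) : C(ℝ, C(AddCircle L, ℝ)) :=
  ContinuousMap.curry ⟨_, continuous_birkhoffSum_angle (continuous_circleSin h1) (3 ^ m * 3 ^ m)⟩

/-- The renormalized tent function of frequency `3 ^ m`. -/
noncomputable def tentWave (L : ℝ) [Fact (0 < L)] (m : ℕ) : C(AddCircle L, ℝ) :=
  ⟨fun y => circleTent L (3 ^ m • y), continuous_circleTent.comp (continuous_nsmul _)⟩

/-- The angles for which some Birkhoff sum beyond `k` is close to a tent function. -/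
def goodAngles (h1 : 1 ≤ L) (k : ℕ) : Set ℝ :=
  ⋃ m : ℕ, ⋃ _ : k ≤ m, {ρ | dist (birkhoffCurve h1 m ρ) (tentWave L m) < 1 / ((k : ℝ) + 1) ∧
    ‖(3 ^ m * 3 ^ m) • ((ρ * L : ℝ) : AddCircle L)‖ < 1 / ((k : ℝ) + 1)}

theorem isOpen_goodAngles (h1 : 1 ≤ L) (k : ℕ) : IsOpen (goodAngles h1 k) := by
  refine isOpen_iUnion fun m => isOpen_iUnion fun _ => IsOpen.inter ?_ ?_
  · exact isOpen_lt ((birkhoffCurve h1 m).continuous.dist continuous_const) continuous_const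
  · have h : Continuous fun ρ : ℝ => ((ρ * L : ℝ) : AddCircle L) :=
      (AddCircle.continuous_mk' L).comp (by fun_prop)
    exact isOpen_lt ((continuous_nsmul _).comp h).norm continuous_const

/-- The hypothesis says that 3^n/L is a half-integer; multiplying by the odd number 3^(m-n) keeps it
one. The numerator 3j + 1 is prime to 3, so the rational estimate applies with q = 3^m, and q² steps
of this rotation are exactly the identity. -/
theorem mem_goodAngles (h1 : 1 ≤ L) {n i m k : ℕ} (hL' : (2 * 3 ^ n : ℝ) = (2 * i + 1) * L)
    (hnm : n ≤ m) (hkm : k ≤ m) (hm : Real.pi * L ≤ 2 * 3 ^ m)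
    (hm' : Real.pi ^ 2 * L ^ 2 / (2 * 3 ^ m) < 1 / ((k : ℝ) + 1)) (j : ℤ) :
    ((3 * j + 1 : ℤ) : ℝ) / 3 ^ m ∈ goodAngles h1 k := by
  have hLpos : 0 < L := hL.out
  refine Set.mem_iUnion₂.2 ⟨m, hkm, ?_⟩
  have hq0 : NeZero (3 ^ m) := ⟨by positivity⟩
  have hp : IsUnit ((3 * j + 1 : ℤ) : ZMod (3 ^ m)) := by
    rw [ZMod.coe_int_isUnit_iff_isCoprime, isCoprime_comm]
    push_cast
    exact IsCoprime.pow_right ⟨1, -j, by ring⟩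
  obtain ⟨N, hN⟩ : Odd (3 ^ (m - n) * (2 * i + 1)) :=
    (Odd.pow (by decide)).mul ⟨i, rfl⟩
  have hqN : ((3 ^ m : ℕ) : ℝ) = (N + 1 / 2) * L := by
    have h2 : ((3 ^ (m - n) * (2 * i + 1) : ℕ) : ℝ) = 2 * N + 1 := by
      rw [hN]; push_cast; ring
    have h3 : (3 : ℝ) ^ m = 3 ^ (m - n) * 3 ^ n := by
      rw [← pow_add, Nat.sub_add_cancel hnm]
    push_cast at h2 ⊢
    have h4 : (3 : ℝ) ^ n = (2 * i + 1) * L / 2 := by linarith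
    rw [h3, h4, show (N : ℝ) + 1 / 2 = (2 * N + 1) / 2 by ring, ← h2]
    ring
  have hρ : ((3 * j + 1 : ℤ) : ℝ) / 3 ^ m * L = ((3 * j + 1 : ℤ) : ℝ) * (L / (3 ^ m : ℕ)) := by
    push_cast; ring
  constructor
  · rw [ContinuousMap.dist_lt_iff (by positivity)]
    intro y
    have hb := birkhoffSum_circleSin_sub_tent_le h1 hqN (by push_cast; exact hm) hp y
    rw [← hρ] at hb
    rw [Real.dist_eq]
    refine lt_of_le_of_lt hb ?_
    push_cast
    exact hm'
  · have : (3 ^ m * 3 ^ m) • ((((3 * j + 1 : ℤ) : ℝ) / 3 ^ m * L : ℝ) : AddCircle L) = 0 := by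
      rw [← AddCircle.coe_nsmul, nsmul_eq_mul]
      have h2 : ((3 ^ m * 3 ^ m : ℕ) : ℝ) * (((3 * j + 1 : ℤ) : ℝ) / 3 ^ m * L)
          = (3 ^ m * (3 * j + 1) : ℤ) • L := by
        rw [zsmul_eq_mul]; push_cast; field_simp
      rw [h2, AddCircle.coe_zsmul, AddCircle.coe_period, smul_zero]
    rw [this, norm_zero]
    positivity

theorem dense_goodAngles (h1 : 1 ≤ L) {n i : ℕ} (hL' : (2 * 3 ^ n : ℝ) = (2 * i + 1) * L)
    (k : ℕ) : Dense (goodAngles h1 k) := by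
  rw [Metric.dense_iff]
  intro ρ ε hε
  have h3 : Tendsto (fun m : ℕ => (3 : ℝ) ^ m) atTop atTop :=
    tendsto_pow_atTop_atTop_of_one_lt (by norm_num)
  have h4 : Tendsto (fun m : ℕ => Real.pi ^ 2 * L ^ 2 / (2 * (3 : ℝ) ^ m)) atTop (𝓝 0) :=
    tendsto_const_nhds.div_atTop (h3.const_mul_atTop two_pos)
  have h5 : Tendsto (fun m : ℕ => 3 / (3 : ℝ) ^ m) atTop (𝓝 0) :=
    tendsto_const_nhds.div_atTop h3
  obtain ⟨m, hnm, hkm, ha, hb, hc⟩ := ((eventually_ge_atTop n).and ((eventually_ge_atTop k).and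
    (((h3.const_mul_atTop two_pos).eventually_ge_atTop (Real.pi * L)).and
      ((h4.eventually_lt_const (by positivity : (0 : ℝ) < 1 / ((k : ℝ) + 1))).and
        (h5.eventually_lt_const hε))))).exists
  set j := ⌊3 ^ m * ρ / 3⌋ with hj
  refine ⟨((3 * j + 1 : ℤ) : ℝ) / 3 ^ m, ?_, mem_goodAngles h1 hL' hnm hkm ha hb j⟩
  have hpos : (0 : ℝ) < 3 ^ m := by positivity
  rw [Metric.mem_ball, Real.dist_eq]
  refine lt_of_le_of_lt ?_ hc
  have h6 := Int.floor_le (3 ^ m * ρ / 3)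
  have h7 := Int.lt_floor_add_one (3 ^ m * ρ / 3)
  rw [← hj] at h6 h7
  have e : ((3 * j + 1 : ℤ) : ℝ) / 3 ^ m - ρ = (3 * j + 1 - 3 ^ m * ρ) / 3 ^ m := by
    push_cast; field_simp
  rw [e, abs_div, abs_of_pos hpos]
  refine div_le_div_of_nonneg_right ?_ hpos.le
  rw [abs_le]; constructor <;> linarith

/-- On circles of suitable lengths, the skew product with `circleSin` over the generic rotation
is ergodic. -/
theorem eventually_residual_preErgodic (h1 : 1 ≤ L) {n i : ℕ}
    (hL' : (2 * 3 ^ n : ℝ) = (2 * i + 1) * L) :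
    ∀ᶠ ρ in residual ℝ, PreErgodic (skewProduct (· + ((ρ * L : ℝ) : AddCircle L)) (circleSin L))
      ((volume : Measure (AddCircle L)).prod volume) := by
  have hLpos : 0 < L := hL.out
  have hres : ∀ᶠ ρ in residual ℝ, ∀ k, ρ ∈ goodAngles h1 k :=
    eventually_countable_forall.2 fun k =>
      residual_of_dense_open (isOpen_goodAngles h1 k) (dense_goodAngles h1 hL' k)
  filter_upwards [hres, eventually_residual_irrational] with ρ hρ hirr
  have hex : ∀ k, ∃ m, k ≤ m ∧ dist (birkhoffCurve h1 m ρ) (tentWave L m) < 1 / ((k : ℝ) + 1) ∧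
      ‖(3 ^ m * 3 ^ m) • ((ρ * L : ℝ) : AddCircle L)‖ < 1 / ((k : ℝ) + 1) := by
    intro k
    obtain ⟨m, hm, h⟩ := Set.mem_iUnion₂.1 (hρ k)
    exact ⟨m, hm, h⟩
  choose m hm hd hn using hex
  refine preErgodic_skewProduct_rotation (continuous_circleSin h1) continuous_circleTent ?_
    (fun ε hε => circleTent_small hε) (n := fun k => 3 ^ m k * 3 ^ m k) (q := fun k => 3 ^ m k)
    ?_ ?_ ?_
  · rw [addOrderOf_eq_zero_iff, AddCircle.not_isOfFinAddOrder_iff_forall_rat_ne_div]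
    intro r
    rw [mul_div_cancel_right₀ _ hLpos.ne']
    exact fun h => hirr ⟨r, h⟩
  · exact tendsto_atTop_mono (fun k => (hm k).trans (Nat.lt_pow_self (by norm_num)).le) tendsto_id
  · rw [tendsto_zero_iff_norm_tendsto_zero]
    exact squeeze_zero (fun k => norm_nonneg _) (fun k => (hn k).le)
      tendsto_one_div_add_atTop_nhds_zero_nat
  · intro ε hε
    filter_upwards [tendsto_one_div_add_atTop_nhds_zero_nat.eventually_lt_const hε] with k hk y
    have := ContinuousMap.dist_apply_le_dist (f := birkhoffCurve h1 (m k) ρ)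
      (g := tentWave L (m k)) y
    rw [Real.dist_eq] at this
    exact lt_of_le_of_lt this ((hd k).trans hk)

end Generic

/-! ### Density of the ergodic parameters. -/

/-- The length vector of the exchange that is the first return map of the rotation by the angle
`ρ` of the circle whose length is the inverse of `β`. -/
noncomputable def lengthsOf (x : ℝ × ℝ) : Fin 3 → ℝ :=
  ![1 - x.2 / x.1, 1 / x.1 - 1, x.2 / x.1 - 1 / x.1 + 1]

/-- In the coordinates β = 1/L and ρ = α/L, the values β = (2i + 1)/(2·3^n) are dense, and for each
admissible one the generic ρ gives an ergodic skew product. -/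
theorem dense_ergodic_lengths :
    Dense {len : lengthSimplex | Ergodic (skewProduct (symIet len.1)
      (fun x : ℝ => Real.sin (2 * Real.pi * x))) cylinderMeasure} := by
  intro len
  rw [mem_closure_iff]
  intro U hU hlen
  obtain ⟨V, hV, rfl⟩ := isOpen_induced_iff.1 hU
  have hpos := len.2.1
  have hsum := len.2.2
  rw [Fin.sum_univ_three] at hsum
  set b := len.1 1 with hb
  have hb0 : 0 < b := hpos 1
  have ha0 := hpos 0
  have hc0 := hpos 2
  set x₀ : ℝ × ℝ := (1 / (1 + b), (1 - len.1 0) / (1 + b)) with hx₀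
  have hlx : lengthsOf x₀ = len.1 := by
    have h1 : (1 - len.1 0) / (1 + b) / (1 / (1 + b)) = 1 - len.1 0 := by field_simp
    have h2 : 1 / (1 / (1 + b)) = 1 + b := by field_simp
    ext j
    fin_cases j
    · simp only [lengthsOf, hx₀, h1]; simp
    · simp only [lengthsOf, hx₀, h2]; simp [hb]
    · simp only [lengthsOf, hx₀, h1, h2]; simp; linarith
  have hx0 : x₀.1 ≠ 0 := by simp only [hx₀]; positivity
  have hcont : ContinuousAt lengthsOf x₀ := by
    refine continuousAt_pi.2 fun j => ?_
    fin_cases j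
    · exact continuousAt_const.sub (continuousAt_snd.div continuousAt_fst hx0)
    · exact (continuousAt_const.div continuousAt_fst hx0).sub continuousAt_const
    · exact ((continuousAt_snd.div continuousAt_fst hx0).sub
        (continuousAt_const.div continuousAt_fst hx0)).add continuousAt_const
  have hnhds : V ∩ {l : Fin 3 → ℝ | ∀ a, 0 < l a} ∈ 𝓝 (lengthsOf x₀) := by
    rw [hlx]
    refine inter_mem (hV.mem_nhds hlen) ?_
    have : IsOpen {l : Fin 3 → ℝ | ∀ a, 0 < l a} := by
      simp only [Set.ofPred_forall]
      exact isOpen_iInter_of_finite fun a => isOpen_lt continuous_const (continuous_apply a)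
    exact this.mem_nhds hpos
  have hnear := hcont.preimage_mem_nhds hnhds
  rw [nhds_prod_eq, mem_prod_iff] at hnear
  obtain ⟨A, hA, B, hB, hAB⟩ := hnear
  obtain ⟨n, i, hi⟩ : ∃ n i : ℕ, ((2 * i + 1 : ℝ) / (2 * 3 ^ n)) ∈ A := by
    obtain ⟨ε, hε, hball⟩ := Metric.mem_nhds_iff.1 hA
    have h3 : Tendsto (fun m : ℕ => (3 : ℝ) ^ m) atTop atTop :=
      tendsto_pow_atTop_atTop_of_one_lt (by norm_num)
    have h5 : Tendsto (fun m : ℕ => 1 / (3 : ℝ) ^ m) atTop (𝓝 0) :=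
      tendsto_const_nhds.div_atTop h3
    obtain ⟨n, hn⟩ := (h5.eventually_lt_const hε).exists
    have hx1 : 0 ≤ 3 ^ n * x₀.1 := by simp only [hx₀]; positivity
    refine ⟨n, ⌊3 ^ n * x₀.1⌋₊, hball ?_⟩
    rw [Metric.mem_ball, Real.dist_eq]
    refine lt_of_le_of_lt ?_ hn
    have h6 := Nat.floor_le hx1
    have h7 := Nat.lt_floor_add_one (3 ^ n * x₀.1)
    have hp : (0 : ℝ) < 3 ^ n := by positivity
    set j : ℝ := (⌊3 ^ n * x₀.1⌋₊ : ℝ)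
    have e : (2 * j + 1) / (2 * 3 ^ n) - x₀.1 = (j + 1 / 2 - 3 ^ n * x₀.1) / 3 ^ n := by
      field_simp
    rw [e, abs_div, abs_of_pos hp]
    refine div_le_div_of_nonneg_right ?_ hp.le
    rw [abs_le]; constructor <;> linarith
  set β : ℝ := (2 * i + 1 : ℝ) / (2 * 3 ^ n) with hβ
  have hβ0 : 0 < β := by positivity
  have hL : Fact (0 < 1 / β) := ⟨by positivity⟩
  have hL' : (2 * 3 ^ n : ℝ) = (2 * i + 1) * (1 / β) := by rw [hβ]; field_simp
  have h1L : 1 ≤ 1 / β := by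
    have := (hAB (Set.mk_mem_prod hi (mem_of_mem_nhds hB))).2 1
    simp only [lengthsOf] at this
    simp at this
    rw [one_div]
    exact this.le
  have hdense := dense_of_mem_residual (eventually_residual_preErgodic h1L hL')
  obtain ⟨ρ, hρ, hρB⟩ := hdense.inter_nhds_nonempty hB
  have hmem := hAB (Set.mk_mem_prod hi hρB)
  have hl : lengthsOf (β, ρ) ∈ lengthSimplex := by
    refine ⟨hmem.2, ?_⟩
    rw [Fin.sum_univ_three]
    simp [lengthsOf]
    ring
  refine ⟨⟨lengthsOf (β, ρ), hl⟩, hmem.1, ?_⟩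
  refine ergodic_skewProduct_symIet (L := 1 / β) hl (by simp [lengthsOf]) ?_
  have e : lengthsOf (β, ρ) 1 + lengthsOf (β, ρ) 2 = ρ * (1 / β) := by
    simp [lengthsOf]; ring
  rw [e]
  exact hρ

/-! ### Small divisors. -/

/-- Near 0 the integrand is at most |x|^(-3/4). The exponent 3/4 is below 1, for integrability, and
above 1/2, so that (n⁻²)^(3/4) remains summable. -/
theorem lintegral_fourier_one_sub_one_rpow_lt_top :
    ∫⁻ x : UnitAddCircle, ‖fourier 1 x - 1‖ₑ ^ (-(3 / 4) : ℝ) < ∞ := by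
  rw [← UnitAddCircle.lintegral_preimage (-(1 / 2))]
  have hI : IntervalIntegrable (fun x : ℝ => ‖(x : ℂ) ^ (((-(3 / 4) : ℝ)) : ℂ)‖) volume
      (-(1 / 2)) (-(1 / 2) + 1) :=
    (intervalIntegral.intervalIntegrable_cpow' (by rw [Complex.ofReal_re]; norm_num)).norm
  rw [intervalIntegrable_iff_integrableOn_Ioc_of_le (by norm_num)] at hI
  refine lt_of_le_of_lt ?_ hI.lintegral_lt_top
  refine lintegral_mono_ae ?_
  filter_upwards [ae_restrict_mem measurableSet_Ioc, ae_restrict_of_ae (Measure.ae_ne volume (0 : ℝ))]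
    with x hx hx0
  have habs : |x| ≤ 1 / 2 := abs_le.2 ⟨hx.1.le, by linarith [hx.2]⟩
  have hpos : 0 < |x| := abs_pos.2 hx0
  have hlow : |x| ≤ ‖fourier 1 (x : UnitAddCircle) - 1‖ := by
    have h1 : fourier 1 (x : UnitAddCircle)
        = Complex.exp (Complex.I * ((2 * Real.pi * x : ℝ) : ℂ)) := by
      rw [fourier_coe_apply]; congr 1; push_cast; ring
    rw [h1, Complex.norm_exp_I_mul_ofReal_sub_one, Real.norm_eq_abs, abs_mul, abs_two]
    have h2 : |2 * Real.pi * x / 2| ≤ Real.pi / 2 := by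
      rw [show 2 * Real.pi * x / 2 = Real.pi * x by ring, abs_mul, abs_of_pos Real.pi_pos]
      nlinarith [Real.pi_pos]
    have h3 := Real.mul_abs_le_abs_sin h2
    have h4 : 2 / Real.pi * |2 * Real.pi * x / 2| = 2 * |x| := by
      rw [show 2 * Real.pi * x / 2 = Real.pi * x by ring, abs_mul, abs_of_pos Real.pi_pos]
      field_simp
    linarith
  rw [Complex.norm_cpow_real, Complex.norm_real, Real.norm_eq_abs,
    ← ENNReal.ofReal_rpow_of_pos hpos]
  rw [ENNReal.rpow_neg, ENNReal.rpow_neg, ENNReal.inv_le_inv]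
  refine ENNReal.rpow_le_rpow ?_ (by norm_num)
  rw [← ofReal_norm]
  exact ENNReal.ofReal_le_ofReal hlow

theorem fourier_eq_fourier_one_zsmul {T : ℝ} (n : ℤ) (x : AddCircle T) :
    fourier n x = fourier 1 (n • x) := by
  rw [fourier_apply, fourier_apply, one_smul]

/-- For almost every angle the small divisors are controlled. -/
theorem ae_summable_small_divisors :
    ∀ᵐ x : UnitAddCircle, (∀ n : ℤ, n ≠ 0 → fourier n x ≠ 1) ∧
      Summable fun n : ℤ => ‖fourier n x - 1‖⁻¹ * ((n : ℝ) ^ 2)⁻¹ := by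
  set h : UnitAddCircle → ℝ≥0∞ := fun x => ‖fourier 1 x - 1‖ₑ ^ (-(3 / 4) : ℝ) with hh
  have hm : Measurable h := by
    have : Continuous fun x : UnitAddCircle => (fourier 1 x : ℂ) - 1 :=
      (fourier 1).continuous.sub continuous_const
    exact this.measurable.enorm.pow_const _
  set a : ℤ → ℝ := fun n => |(n : ℝ)| ^ (-(3 / 2) : ℝ) with ha
  have hasum : Summable a := Real.summable_abs_int_rpow (by norm_num)
  have ha0 : ∀ n, 0 ≤ a n := fun n => Real.rpow_nonneg (abs_nonneg _) _
  have hmn (n : ℤ) : Measurable fun x => h (n • x) :=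
    hm.comp (continuous_zsmul n).measurable
  have hint : ∀ n : ℤ, ∫⁻ x, ENNReal.ofReal (a n) * h (n • x)
      = ENNReal.ofReal (a n) * ∫⁻ x, h x := by
    intro n
    rw [lintegral_const_mul _ (hmn n)]
    -- Multiplication by n preserves the measure only for n ≠ 0; at n = 0 the coefficient is 0,
    -- since `0 ^ (-(3 / 2))` is 0 by convention.
    by_cases hn : n = 0
    · simp [hn, ha]
    · rw [(Measure.measurePreserving_zsmul (volume : Measure UnitAddCircle) hn).lintegral_comp hm]
  have hfin : ∫⁻ x, ∑' n : ℤ, ENNReal.ofReal (a n) * h (n • x) ≠ ∞ := by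
    rw [lintegral_tsum fun n => ((hmn n).const_mul _).aemeasurable]
    simp only [hint]
    rw [ENNReal.tsum_mul_right]
    exact ENNReal.mul_ne_top hasum.tsum_ofReal_ne_top
      lintegral_fourier_one_sub_one_rpow_lt_top.ne
  have hae := ae_lt_top' (AEMeasurable.tsum fun n : ℤ =>
    ((hmn n).const_mul (ENNReal.ofReal (a n))).aemeasurable) hfin
  filter_upwards [hae] with x hx
  have hne : ∀ n : ℤ, n ≠ 0 → fourier n x ≠ 1 := by
    intro n hn h1
    have h2 := ENNReal.ne_top_of_tsum_ne_top hx.ne n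
    have h3 : h (n • x) = ∞ := by
      simp only [hh]
      rw [← fourier_eq_fourier_one_zsmul, h1, sub_self, enorm_zero,
        ENNReal.zero_rpow_of_neg (by norm_num)]
    have h4 : 0 < a n := Real.rpow_pos_of_pos (abs_pos.2 (by exact_mod_cast hn)) _
    rw [h3, ENNReal.mul_top (by simpa using h4)] at h2
    exact h2 rfl
  refine ⟨hne, ?_⟩
  set r : ℤ → ℝ := fun n => ‖fourier n x - 1‖⁻¹ * ((n : ℝ) ^ 2)⁻¹ with hr
  have hr0 : ∀ n, 0 ≤ r n := fun n => by positivity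
  have hpow : Summable fun n => r n ^ (3 / 4 : ℝ) := by
    have h1 := ENNReal.summable_toReal hx.ne
    refine h1.congr fun n => ?_
    by_cases hn : n = 0
    · simp [hn, hr, ha]
    have hnpos : 0 < |(n : ℝ)| := abs_pos.2 (by exact_mod_cast hn)
    have hdpos : 0 < ‖fourier n x - 1‖ := norm_pos_iff.2 (sub_ne_zero.2 (hne n hn))
    rw [ENNReal.toReal_mul, ENNReal.toReal_ofReal (ha0 n)]
    simp only [hh, hr, ha]
    rw [← fourier_eq_fourier_one_zsmul, ← ENNReal.toReal_rpow, toReal_enorm,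
      Real.mul_rpow (by positivity) (by positivity), Real.rpow_neg hdpos.le,
      Real.inv_rpow hdpos.le, mul_comm]
    congr 1
    rw [← sq_abs, ← Real.rpow_natCast, ← Real.rpow_neg hnpos.le, ← Real.rpow_mul hnpos.le]
    norm_num
  -- The terms r are eventually at most 1, where r ≤ r^(3/4).
  have htend := hpow.tendsto_cofinite_zero
  refine Summable.of_norm_bounded_eventually hpow ?_
  filter_upwards [htend.eventually_lt_const one_pos] with n hn
  rw [Real.norm_of_nonneg (hr0 n)]
  have h1 : r n ≤ 1 := by
    by_contra h2
    exact absurd hn (not_lt.2 (Real.one_le_rpow (not_le.1 h2).le (by norm_num)))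
  rcases (hr0 n).eq_or_lt with h0 | h0
  · rw [← h0, Real.zero_rpow (by norm_num)]
  · calc r n = r n ^ (1 : ℝ) := (Real.rpow_one _).symm
      _ ≤ r n ^ (3 / 4 : ℝ) := Real.rpow_le_rpow_of_exponent_ge h0 h1 (by norm_num)

/-! ### Fourier coefficients and the cohomological equation. -/

theorem integral_exp_mul_sin {ω : ℝ} (hω : ω ^ 2 ≠ (2 * Real.pi) ^ 2) :
    ∫ x in (0 : ℝ)..1, Complex.exp (Complex.I * ω * x) * (Real.sin (2 * Real.pi * x) : ℂ)
      = 2 * Real.pi * (1 - Complex.exp (Complex.I * ω)) / ((2 * Real.pi) ^ 2 - ω ^ 2) := by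
  have hne : ((2 * Real.pi : ℂ) ^ 2 - (ω : ℂ) ^ 2) ≠ 0 := by
    rw [sub_ne_zero]
    exact_mod_cast hω.symm
  have hderiv : ∀ x : ℝ, HasDerivAt (fun x : ℝ => Complex.exp (Complex.I * ω * x) *
      (Complex.I * ω * (Real.sin (2 * Real.pi * x) : ℂ)
        - 2 * Real.pi * (Real.cos (2 * Real.pi * x) : ℂ)) / ((2 * Real.pi) ^ 2 - ω ^ 2))
      (Complex.exp (Complex.I * ω * x) * (Real.sin (2 * Real.pi * x) : ℂ)) x := by
    intro x
    have h0 : HasDerivAt (fun x : ℝ => (x : ℂ)) 1 x := Complex.ofRealCLM.hasDerivAt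
    have h1 := (h0.const_mul (Complex.I * ω)).cexp
    have hk : HasDerivAt (fun x : ℝ => 2 * Real.pi * x) (2 * Real.pi * 1) x :=
      (hasDerivAt_id x).const_mul _
    have h2 := (hk.sin.ofReal_comp).const_mul (Complex.I * ω)
    have h3 := (hk.cos.ofReal_comp).const_mul (2 * Real.pi : ℂ)
    have h4 := (h1.mul (h2.sub h3)).div_const (((2 * Real.pi) ^ 2 - ω ^ 2 : ℂ))
    refine h4.congr_deriv ?_
    simp only [Pi.sub_apply]
    rw [div_eq_iff hne]
    push_cast
    linear_combination (Complex.exp (Complex.I * ω * x) * ω ^ 2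
      * Complex.sin (2 * Real.pi * x)) * Complex.I_sq
  rw [intervalIntegral.integral_eq_sub_of_hasDerivAt (fun x _ => hderiv x)
    (Continuous.intervalIntegrable (by fun_prop) _ _)]
  simp
  ring

section Coboundary

variable {L : ℝ} [hL : Fact (0 < L)]

/-- `circleSin` as a continuous complex-valued function. -/
noncomputable def circleSinC (h1 : 1 ≤ L) : C(AddCircle L, ℂ) :=
  ⟨fun y => (circleSin L y : ℂ), Complex.continuous_ofReal.comp (continuous_circleSin h1)⟩

theorem fourierCoeff_circleSinC (h1 : 1 < L) (h2 : L < 2) (n : ℤ) :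
    fourierCoeff (circleSinC h1.le) n = (1 / L : ℝ) • (2 * Real.pi *
      (1 - Complex.exp (Complex.I * (-(2 * Real.pi * n / L) : ℝ)))
        / ((2 * Real.pi) ^ 2 - ((-(2 * Real.pi * n / L) : ℝ) : ℂ) ^ 2)) := by
  have hLpos : 0 < L := hL.out
  -- No resonance: n² = L² would be a square of an integer strictly between 1 and 4.
  have hω : (-(2 * Real.pi * n / L)) ^ 2 ≠ (2 * Real.pi) ^ 2 := by
    intro h
    have hπ := Real.pi_pos
    have h3 : ((n : ℝ)) ^ 2 = L ^ 2 := by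
      field_simp at h
      nlinarith
    have h4 : (1 : ℝ) < (n : ℝ) ^ 2 := by rw [h3]; nlinarith
    have h5 : (n : ℝ) ^ 2 < 4 := by rw [h3]; nlinarith
    have h6 : 1 < n ^ 2 := by exact_mod_cast h4
    have h7 : n ^ 2 < 4 := by exact_mod_cast h5
    have h8 : n < 2 := by nlinarith
    have h9 : -2 < n := by nlinarith
    interval_cases n <;> simp at h6
  rw [fourierCoeff_eq_intervalIntegral _ _ 0, zero_add, ← integral_exp_mul_sin hω]
  congr 1
  have hcont : Continuous fun x : ℝ =>
      @fourier L (-n) x • circleSinC h1.le (x : AddCircle L) := by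
    have := AddCircle.continuous_mk' L
    exact (((fourier (-n)).continuous.comp this).smul ((circleSinC h1.le).continuous.comp this))
  rw [← intervalIntegral.integral_add_adjacent_intervals (b := 1)
    (hcont.intervalIntegrable _ _) (hcont.intervalIntegrable _ _)]
  have hzero : ∫ x in (1 : ℝ)..L, @fourier L (-n) x • circleSinC h1.le (x : AddCircle L) = 0 := by
    rw [intervalIntegral.integral_of_le h1.le, ← integral_Ico_eq_integral_Ioc]
    refine setIntegral_eq_zero_of_forall_eq_zero fun x hx => ?_
    simp [circleSinC, circleSin_of_one_le hx.1 hx.2]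
  rw [hzero, add_zero, intervalIntegral.integral_of_le zero_le_one,
    intervalIntegral.integral_of_le zero_le_one, ← integral_Ico_eq_integral_Ioc,
    ← integral_Ico_eq_integral_Ioc]
  refine setIntegral_congr_fun measurableSet_Ico fun x hx => ?_
  change @fourier L (-n) x • (circleSin L (x : AddCircle L) : ℂ) = _
  rw [circleSin_of_lt_one h1.le hx.1 hx.2, fourier_coe_apply, smul_eq_mul]
  congr 2
  push_cast; ring

/-- The numerator is bounded and the denominator grows quadratically. At n = 0 the right side is 0
by convention, so the bound also records that the mean vanishes. -/
theorem exists_norm_fourierCoeff_circleSinC_le (h1 : 1 < L) (h2 : L < 2) :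
    ∃ C, ∀ n : ℤ, ‖fourierCoeff (circleSinC h1.le) n‖ ≤ C * ((n : ℝ) ^ 2)⁻¹ := by
  have hLpos : 0 < L := hL.out
  have hπ := Real.pi_pos
  -- The two entries bound |1 - n²/L²| / n² from below for n² = 1 and for n² ≥ 4.
  set c := min (1 - (L ^ 2)⁻¹) ((L ^ 2)⁻¹ - 1 / 4) with hc
  have hL1 : (L ^ 2)⁻¹ < 1 := inv_lt_one_of_one_lt₀ (by nlinarith)
  have hL4 : 1 / 4 < (L ^ 2)⁻¹ := by
    rw [one_div]; exact inv_strictAnti₀ (by positivity) (by nlinarith)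
  have hc0 : 0 < c := lt_min (by linarith) (by linarith)
  have hc1 : c ≤ 1 - (L ^ 2)⁻¹ := min_le_left _ _
  have hc2 : c ≤ (L ^ 2)⁻¹ - 1 / 4 := min_le_right _ _
  refine ⟨(1 / L) * (2 * Real.pi * 2 / ((2 * Real.pi) ^ 2 * c)), fun n => ?_⟩
  rw [fourierCoeff_circleSinC h1 h2]
  by_cases hn : n = 0
  · simp [hn]
  have hlow : c * (n : ℝ) ^ 2 ≤ |1 - (n : ℝ) ^ 2 * (L ^ 2)⁻¹| := by
    by_cases h3 : n ^ 2 = 1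
    · have : (n : ℝ) ^ 2 = 1 := by exact_mod_cast h3
      rw [this, one_mul, mul_one]
      exact hc1.trans (le_abs_self _)
    · have h4 : 4 ≤ n ^ 2 := by
        have h5 : 2 ≤ |n| := by
          have h6 := Int.one_le_abs hn
          by_contra h7
          have h8 : |n| = 1 := by lia
          exact h3 (by rw [← sq_abs, h8]; rfl)
        rw [← sq_abs]; nlinarith
      have h5 : (4 : ℝ) ≤ (n : ℝ) ^ 2 := by exact_mod_cast h4
      rw [abs_sub_comm]
      refine le_trans ?_ (le_abs_self _)
      nlinarith
  have hnpos : 0 < (n : ℝ) ^ 2 := by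
    have : (n : ℝ) ≠ 0 := by exact_mod_cast hn
    positivity
  have hden : ‖((2 * Real.pi : ℂ) ^ 2 - ((-(2 * Real.pi * n / L) : ℝ) : ℂ) ^ 2)‖
      = (2 * Real.pi) ^ 2 * |1 - (n : ℝ) ^ 2 * (L ^ 2)⁻¹| := by
    have : ((2 * Real.pi : ℂ) ^ 2 - ((-(2 * Real.pi * n / L) : ℝ) : ℂ) ^ 2)
        = (((2 * Real.pi) ^ 2 * (1 - (n : ℝ) ^ 2 * (L ^ 2)⁻¹) : ℝ) : ℂ) := by
      push_cast; field_simp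
    rw [this, Complex.norm_real, Real.norm_eq_abs, abs_mul, abs_of_pos (by positivity)]
  have hnum : ‖(1 : ℂ) - Complex.exp (Complex.I * (-(2 * Real.pi * n / L) : ℝ))‖ ≤ 2 := by
    refine (norm_sub_le _ _).trans ?_
    rw [mul_comm, Complex.norm_exp_ofReal_mul_I, norm_one]
    norm_num
  rw [norm_smul, Real.norm_of_nonneg (by positivity), norm_div, norm_mul, hden]
  have h2π : ‖(2 * Real.pi : ℂ)‖ = 2 * Real.pi := by
    rw [norm_mul, Complex.norm_real, Real.norm_of_nonneg hπ.le]; simp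
  rw [h2π, mul_assoc (1 / L)]
  refine mul_le_mul_of_nonneg_left ?_ (by positivity)
  calc _ ≤ 2 * Real.pi * 2 / ((2 * Real.pi) ^ 2 * (c * (n : ℝ) ^ 2)) := by gcongr
    _ = _ := by field_simp

/-- Under a summability condition on the small divisors, `circleSin` is a coboundary of the
rotation. -/
theorem exists_circleSin_coboundary (h1 : 1 < L) (h2 : L < 2) {α : AddCircle L}
    (hα : ∀ n : ℤ, n ≠ 0 → fourier n α ≠ 1)
    (hs : Summable fun n : ℤ => ‖fourier n α - 1‖⁻¹ * ((n : ℝ) ^ 2)⁻¹) :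
    ∃ g : AddCircle L → ℝ, Continuous g ∧ ∀ y, g (y + α) - g y = circleSin L y := by
  obtain ⟨C, hC⟩ := exists_norm_fourierCoeff_circleSinC_le h1 h2
  set f := circleSinC (L := L) h1.le with hf
  have hf0 : fourierCoeff f 0 = 0 := by
    have := hC 0
    simpa using this
  have hfs : Summable (fourierCoeff f) :=
    Summable.of_norm_bounded
      ((Real.summable_one_div_int_pow.2 one_lt_two).mul_left C) fun n => by
        simpa [one_div] using hC n
  -- The equation is solved mode by mode; the mode n = 0 needs no solving because the mean is zero.
  set u : ℤ → AddCircle L → ℂ := fun n y =>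
    fourierCoeff f n / (fourier n α - 1) * fourier n y with hu
  have hub : ∀ n y, ‖u n y‖ ≤ C * (‖fourier n α - 1‖⁻¹ * ((n : ℝ) ^ 2)⁻¹) := by
    intro n y
    have h3 : ‖fourier n y‖ = 1 := by rw [fourier_apply]; exact Circle.norm_coe _
    simp only [hu]
    rw [norm_mul, norm_div, h3, mul_one, div_eq_mul_inv]
    calc _ ≤ C * ((n : ℝ) ^ 2)⁻¹ * ‖fourier n α - 1‖⁻¹ :=
          mul_le_mul_of_nonneg_right (hC n) (by positivity)
      _ = _ := by ring
  have husum : ∀ y, Summable fun n => u n y := fun y =>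
    Summable.of_norm_bounded (hs.mul_left C) fun n => hub n y
  have hcont : Continuous fun y => ∑' n, u n y :=
    continuous_tsum (fun n => continuous_const.mul (fourier n).continuous) (hs.mul_left C) hub
  refine ⟨fun y => (∑' n, u n y).re, Complex.continuous_re.comp hcont, fun y => ?_⟩
  have hdiff : (∑' n, u n (y + α)) - ∑' n, u n y = f y := by
    rw [← (husum (y + α)).tsum_sub (husum y),
      ← (has_pointwise_sum_fourier_series_of_summable hfs y).tsum_eq]
    refine tsum_congr fun n => ?_
    by_cases hn : n = 0
    · simp [hu, hn, hf0]
    · have h3 : fourier n α - 1 ≠ 0 := sub_ne_zero.2 (hα n hn)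
      have h4 : fourier n (y + α) = fourier n y * fourier n α := by
        simp only [fourier_apply, smul_add, AddCircle.toCircle_add, Circle.coe_mul]
      simp only [hu]
      rw [h4, smul_eq_mul]
      field_simp
  rw [← Complex.sub_re, hdiff, hf]
  exact Complex.ofReal_re _

end Coboundary

/-! ### Non-ergodicity for almost every length vector. -/

/-- The function t - g(x) is invariant. Ergodicity would make it constant almost everywhere, which
confines t to a single value on almost every fibre. -/
theorem not_ergodic_of_coboundary {len : Fin 3 → ℝ} (hl : len ∈ lengthSimplex) {L : ℝ}
    [hL : Fact (0 < L)] (hLlen : L = 1 + len 1) {g : AddCircle L → ℝ} (hg : Continuous g)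
    (hcob : ∀ y, g (y + ((len 1 + len 2 : ℝ) : AddCircle L)) - g y = circleSin L y) :
    ¬ Ergodic (skewProduct (symIet len) (fun x : ℝ => Real.sin (2 * Real.pi * x)))
      cylinderMeasure := by
  intro herg
  have hl' := hl
  obtain ⟨hp, hs⟩ := hl'
  rw [Fin.sum_univ_three] at hs
  have ha := hp 0; have hb := hp 1; have hc := hp 2
  have h1L : 1 ≤ L := by linarith
  have hcob' : ∀ x : ℝ, g ((x + (len 1 + len 2) : ℝ) : AddCircle L)
      = g (x : AddCircle L) + circleSin L (x : AddCircle L) := by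
    intro x
    rw [AddCircle.coe_add, ← hcob]; ring
  have hper : ∀ x : ℝ, ((x - L : ℝ) : AddCircle L) = x := by
    intro x; simp
  have hstep : ∀ x : ℝ, 0 ≤ x → x < 1 → g (symIet len x : AddCircle L)
      = g (x : AddCircle L) + Real.sin (2 * Real.pi * x) := by
    intro x h0 h1
    rw [← circleSin_of_lt_one (L := L) h1L h0 h1, ← hcob']
    rcases lt_or_ge x (len 0) with h2 | h2
    · rw [symIet_of_lt hl h0 h2]
    rcases lt_or_ge x (len 0 + len 1) with h3 | h3
    · have h4 := hcob' (x + (len 1 + len 2))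
      rw [circleSin_of_one_le (by linarith) (by linarith), add_zero,
        ← hper (x + (len 1 + len 2) + (len 1 + len 2))] at h4
      rw [symIet_of_mid hl h2 h3, ← h4]
      congr 2; linarith
    · rw [symIet_of_ge hl h3 h1, ← hper (x + (len 1 + len 2))]
      congr 2; linarith
  have hmem : ∀ᵐ p ∂cylinderMeasure, p.1 ∈ Set.Ico (0 : ℝ) 1 :=
    Measure.quasiMeasurePreserving_fst.ae (ae_restrict_mem measurableSet_Ico)
  have hgc : Continuous fun p : ℝ × ℝ => p.2 - g (p.1 : AddCircle L) :=
    continuous_snd.sub (hg.comp ((AddCircle.continuous_mk' L).comp continuous_fst))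
  obtain ⟨c, hc⟩ := herg.ae_eq_const_of_ae_eq_comp_ae
    (g := fun p : ℝ × ℝ => p.2 - g (p.1 : AddCircle L)) hgc.aestronglyMeasurable (by
      filter_upwards [hmem] with p hp
      simp only [Function.comp, skewProduct, hstep p.1 hp.1 hp.2]
      ring)
  have hc' := Measure.ae_ae_of_ae_prod hc
  have hne : NeBot (ae ((volume : Measure ℝ).restrict (Set.Ico 0 1))) := by
    rw [ae_neBot, Ne, Measure.restrict_eq_zero]
    simp
  obtain ⟨x, hx⟩ := hc'.exists
  obtain ⟨t, ht1, ht2⟩ := (hx.and (Measure.ae_ne volume (c + g (x : AddCircle L)))).exists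
  apply ht2
  simp only [Function.const] at ht1
  linarith

/-- The angle is (1 - λ_A)/(1 + λ_B), for fixed λ_B a nonconstant affine function of λ_A. By Fubini
the null set of bad angles pulls back to a null set of length vectors. -/
theorem ae_not_ergodic_lengths :
    ∀ᵐ len ∂simplexMeasure, len ∈ lengthSimplex ∧
      ¬ Ergodic (skewProduct (symIet len) (fun x : ℝ => Real.sin (2 * Real.pi * x)))
        cylinderMeasure := by
  set P : ℝ → Prop := fun ρ => (∀ n : ℤ, n ≠ 0 → fourier n (ρ : UnitAddCircle) ≠ 1) ∧
      Summable fun n : ℤ => ‖fourier n (ρ : UnitAddCircle) - 1‖⁻¹ * ((n : ℝ) ^ 2)⁻¹ with hP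
  have hPae : ∀ᵐ ρ : ℝ, ρ ∈ Set.Ioc (0 : ℝ) (0 + 1) → P ρ := by
    rw [← ae_restrict_iff' measurableSet_Ioc]
    exact (UnitAddCircle.measurePreserving_mk 0).quasiMeasurePreserving.ae
      ae_summable_small_divisors
  obtain ⟨N, hNsub, hNm, hN0⟩ := exists_measurable_superset_of_null (ae_iff.1 hPae)
  have hpar : ∀ᵐ p : ℝ × ℝ, 0 < p.2 → (1 - p.1) / (1 + p.2) ∉ N := by
    have hfm : Measurable fun p : ℝ × ℝ => (1 - p.1) / (1 + p.2) := by fun_prop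
    have hSm : MeasurableSet {p : ℝ × ℝ | 0 < p.2 ∧ (1 - p.1) / (1 + p.2) ∈ N} :=
      (measurableSet_lt measurable_const measurable_snd).inter (hfm hNm)
    rw [ae_iff]
    have : {p : ℝ × ℝ | ¬ (0 < p.2 → (1 - p.1) / (1 + p.2) ∉ N)}
        = {p : ℝ × ℝ | 0 < p.2 ∧ (1 - p.1) / (1 + p.2) ∈ N} := by
      ext p; simp
    rw [this, Measure.volume_eq_prod, Measure.prod_apply_symm hSm, lintegral_eq_zero_iff
      (measurable_measure_prodMk_right hSm)]
    refine Eventually.of_forall fun b => ?_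
    by_cases hb : 0 < b
    · have hsub : (fun x => (x, b)) ⁻¹' {p : ℝ × ℝ | 0 < p.2 ∧ (1 - p.1) / (1 + p.2) ∈ N}
          = (fun x => 1 - x) ⁻¹' ((fun x => (1 + b)⁻¹ * x) ⁻¹' N) := by
        ext x; simp [hb, div_eq_inv_mul]
      have hb' : (1 + b)⁻¹ ≠ 0 := by positivity
      change volume _ = 0
      rw [hsub, (Measure.measurePreserving_sub_left volume (1 : ℝ)).measure_preimage
        ((hNm.preimage (measurable_const_mul _)).nullMeasurableSet),
        Real.volume_preimage_mul_left hb', hN0, mul_zero]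
    · simp [hb]
  have hsimp : MeasurableSet lengthSimplex := by
    have h1 : MeasurableSet {len : Fin 3 → ℝ | ∀ a, 0 < len a} := by
      simp only [Set.ofPred_forall]
      exact MeasurableSet.iInter fun a =>
        measurableSet_lt measurable_const (measurable_pi_apply a)
    exact h1.inter (measurableSet_eq_fun (by fun_prop) measurable_const)
  have hQ : ∀ᵐ len ∂simplexMeasure, len ∈ lengthSimplex ∧ (1 - len 0) / (1 + len 1) ∉ N := by
    have hfm : Measurable fun len : Fin 3 → ℝ => (1 - len 0) / (1 + len 1) := by fun_prop
    refine (ae_map_iff measurable_simplexParam.aemeasurable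
      (hsimp.inter (hfm hNm).compl)).2 ?_
    filter_upwards [ae_restrict_of_ae hpar,
      ae_restrict_mem (measurable_simplexParam hsimp)] with p hp hmem
    exact ⟨hmem, hp (hmem.1 1)⟩
  filter_upwards [hQ] with len hlen
  obtain ⟨hl, hN⟩ := hlen
  refine ⟨hl, ?_⟩
  have hs := hl.2
  rw [Fin.sum_univ_three] at hs
  have ha := hl.1 0; have hb := hl.1 1; have hc := hl.1 2
  have hLf : Fact (0 < 1 + len 1) := ⟨by linarith⟩
  have hρ : P ((1 - len 0) / (1 + len 1)) := by
    by_contra hnP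
    refine hN (hNsub fun h => hnP (h ⟨by apply div_pos <;> linarith, ?_⟩))
    rw [zero_add, div_le_one (by linarith)]
    linarith
  have hfour : ∀ n : ℤ, fourier n ((len 1 + len 2 : ℝ) : AddCircle (1 + len 1))
      = fourier n (((1 - len 0) / (1 + len 1) : ℝ) : UnitAddCircle) := by
    intro n
    rw [fourier_coe_apply, fourier_coe_apply, show len 1 + len 2 = 1 - len 0 by linarith]
    congr 1
    push_cast
    ring
  obtain ⟨g, hg, hcob⟩ := exists_circleSin_coboundary (L := 1 + len 1)
    (α := ((len 1 + len 2 : ℝ) : AddCircle (1 + len 1))) (by linarith) (by linarith)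
    (fun n hn => by rw [hfour]; exact hρ.1 n hn) (by simpa only [hfour] using hρ.2)
  exact not_ergodic_of_coboundary hl rfl hg hcob

end IntervalExchange

theorem mainTheorem5 :
    (∀ᵐ len ∂IntervalExchange.simplexMeasure,
      MeasureTheory.MeasurePreserving
          (IntervalExchange.skewProduct (IntervalExchange.symIet len)
            (fun x : ℝ => Real.sin (2 * Real.pi * x)))
          IntervalExchange.cylinderMeasure IntervalExchange.cylinderMeasure ∧
        ¬ Ergodic
          (IntervalExchange.skewProduct (IntervalExchange.symIet len)
            (fun x : ℝ => Real.sin (2 * Real.pi * x)))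
          IntervalExchange.cylinderMeasure) ∧
    Dense {len : IntervalExchange.lengthSimplex |
      Ergodic
        (IntervalExchange.skewProduct (IntervalExchange.symIet len.1)
          (fun x : ℝ => Real.sin (2 * Real.pi * x)))
        IntervalExchange.cylinderMeasure} := by
  refine ⟨?_, IntervalExchange.dense_ergodic_lengths⟩
  filter_upwards [IntervalExchange.ae_not_ergodic_lengths] with len hlen
  exact ⟨IntervalExchange.measurePreserving_skewProduct_symIet hlen.1, hlen.2⟩
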